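/- Let $G$ be a Lie group and let $\mathbb{V}$ be a finite-dimensional real inner product space with an orthogonal representation of $G$. Let $M=G/K\subset\mathbb{V}$ be a $G$-orbit that is a compact smooth submanifold and, with the metric induced from $\mathbb{V}$, a Riemannian symmetric space (for every $y\in M$ there is an isometry of $M$ that fixes $y$ and has differential $-\mathrm{id}$ on $T_yM$). For $u\in\mathbb{V}$ let $V_u$ be the vector field on $M$ whose value at $y$ is the orthogonal projection of $u$ onto $T_yM$. For a vector field $V$ on $M$ with flow $\phi_t$ and an orthonormal $p$-frame $\xi=e_1\wedge\dots\wedge e_p$ of $T_xM$, let \[ \mathcal{Q}_\xi(V):=\left.\frac{\mathrm{d}^2}{\mathrm{d}t^2}\right|_{t=0}\big\|(\phi_t)_*\xi\big\| ,\qquad (\phi_t)_*\xi=(\mathrm{d}\phi_t)_xe_1\wedge\dots\wedge(\mathrm{d}\phi_t)_xe_p , \] where $\|w_1\wedge\dots\wedge w_p\|=\det(\langle w_i,w_j\rangle)^{1/2}$. Let $x\in M$ and let $\{e_1,\dots,e_p,n_1,\dots,n_q\}$ be an orthonormal basis of $T_xM$; put $\xi=e_1\wedge\dots\wedge e_p$.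 Then each field $V_u$ has a flow defined for all times, $t\mapsto\|(\phi_t)_*\xi\|$ is twice continuously differentiable near $t=0$, and for every orthonormal basis $(u_i)$ of $\mathbb{V}$ \[ \sum_i\mathcal{Q}_\xi(V_{u_i})=\sum_{j=1}^{p}\sum_{k=1}^{q}\Big(2\,\|\mathrm{II}(e_j,n_k)\|^2-\big\langle \mathrm{II}(e_j,e_j),\mathrm{II}(n_k,n_k)\big\rangle\Big), \] where $\mathrm{II}$ is the second fundamental form of $M\subset\mathbb{V}$ at $x$, i.e. $\mathrm{II}(X,Y)$ is the component normal to $T_xM$ of the derivative in $\mathbb{V}$, along $X$, of a tangent vector field on $M$ extending $Y$. -/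

import Mathlib

open scoped Manifold ContDiff InnerProductSpace

noncomputable section

namespace SymmetricOrbit

variable {V : Type*} [NormedAddCommGroup V] [InnerProductSpace ℝ V] [FiniteDimensional ℝ V]
  {E : Type*} [NormedAddCommGroup E] [NormedSpace ℝ E]
  {M : Type*} [TopologicalSpace M] [ChartedSpace E M]

/-- The differential at `y` of a map `f : M → V` into a vector space, with values in `V`
itself. For an immersion it identifies `T_y M` with a linear subspace of `V`. -/
def tangentMap (f : M → V) (y : M) : TangentSpace 𝓘(ℝ, E) y →L[ℝ] V :=
  mfderiv 𝓘(ℝ, E) 𝓘(ℝ, V) f y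

/-- The tangent space of the submanifold `f(M) ⊂ V` at `f y`, as a subspace of `V`. -/
def tangentSubspace (f : M → V) (y : M) : Submodule ℝ V :=
  LinearMap.range (tangentMap (E := E) f y).toLinearMap

/-- The metric on `M` induced by the inner product of `V` along `f`. -/
def inducedInner (f : M → V) (y : M) (v w : TangentSpace 𝓘(ℝ, E) y) : ℝ :=
  ⟪tangentMap f y v, tangentMap f y w⟫_ℝ

/-- `f` is an injective smooth immersion; on a compact manifold this is a smooth embedding. -/
structure IsInjectiveImmersion (f : M → V) : Prop where
  contMDiff : ContMDiff 𝓘(ℝ, E) 𝓘(ℝ, V) ∞ f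
  injective : Function.Injective f
  injective_tangentMap : ∀ y : M, Function.Injective (tangentMap (E := E) f y)

/-- `M` with the metric induced by `f` is a Riemannian (globally) symmetric space: around every
point `y` there is an isometry of `M` that fixes `y` and has differential `-id` there. -/
def IsRiemannianSymmetric (f : M → V) : Prop :=
  ∀ y : M, ∃ s : M ≃ₘ^∞⟮𝓘(ℝ, E), 𝓘(ℝ, E)⟯ M,
    (∀ (z : M) (v w : TangentSpace 𝓘(ℝ, E) z),
      inducedInner (E := E) f (s z) (mfderiv 𝓘(ℝ, E) 𝓘(ℝ, E) s z v)
        (mfderiv 𝓘(ℝ, E) 𝓘(ℝ, E) s z w) = inducedInner (E := E) f z v w) ∧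
    s y = y ∧
    ∀ v : E, (mfderiv 𝓘(ℝ, E) 𝓘(ℝ, E) s y v : E) = -v

theorem exists_tangentMap_eq (f : M → V) (u : V) (y : M) :
    ∃ v : TangentSpace 𝓘(ℝ, E) y,
      tangentMap f y v = (tangentSubspace (E := E) f y).starProjection u :=
  Submodule.starProjection_apply_mem (tangentSubspace (E := E) f y) u

/-- The vector field `V_u` on `M`: at `y` it is the tangent vector whose image in `V` is the
orthogonal projection of `u` onto the tangent space of `f(M)` at `f y`
(there is exactly one if `f` is an immersion). -/
def projField (f : M → V) (u : V) (y : M) : TangentSpace 𝓘(ℝ, E) y :=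
  (exists_tangentMap_eq f u y).choose

/-- The second fundamental form of `f(M) ⊂ V` at `x`: the normal component of the derivative in
`V` along `X` of the vector field that extends `Y` with constant coefficients in the chart at `x`.
(A vector of `TangentSpace 𝓘(ℝ, E) x` is the vector of its coefficients in this chart.) -/
def secondFundamentalForm (f : M → V) (x : M) (X Y : TangentSpace 𝓘(ℝ, E) x) : V :=
  (tangentSubspace (E := E) f x)ᗮ.starProjection
    (fderiv ℝ (fun z : E => fderiv ℝ (f ∘ (extChartAt 𝓘(ℝ, E) x).symm) z Y)
      (extChartAt 𝓘(ℝ, E) x x) X)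

open Classical in
/-- The flow `φ_t` of a vector field: `t ↦ flow v t y` is the integral curve that starts at `y`.
(A smooth field on a compact manifold has exactly one; `y` is a default value otherwise.) -/
def flow (v : (y : M) → TangentSpace 𝓘(ℝ, E) y) (t : ℝ) (y : M) : M :=
  if h : ∃ γ : ℝ → M, γ 0 = y ∧ IsMIntegralCurve (I := 𝓘(ℝ, E)) γ v then h.choose t else y

/-- The norm `‖w_1 ∧ ⋯ ∧ w_p‖` in `Λ^p T_y M` for the induced metric:
the square root of the Gram determinant. -/
def wedgeNorm (f : M → V) {p : ℕ} (y : M) (w : Fin p → TangentSpace 𝓘(ℝ, E) y) : ℝ :=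
  Real.sqrt (Matrix.of fun i j => inducedInner (E := E) f y (w i) (w j)).det

/-- `t ↦ ‖(φ_t)_* ξ‖` for the flow `φ_t` of the field `v` and `ξ = e_1 ∧ ⋯ ∧ e_p` at `x`. -/
def pushforwardNorm (f : M → V) (v : (y : M) → TangentSpace 𝓘(ℝ, E) y) {p : ℕ} (x : M)
    (e : Fin p → TangentSpace 𝓘(ℝ, E) x) (t : ℝ) : ℝ :=
  wedgeNorm (E := E) f (flow v t x) fun j => mfderiv 𝓘(ℝ, E) 𝓘(ℝ, E) (flow v t) x (e j)

/-- The second variation `Q_ξ(v) = d²/dt²|_{t=0} ‖(φ_t)_* ξ‖`. -/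
def secondVariation (f : M → V) (v : (y : M) → TangentSpace 𝓘(ℝ, E) y) {p : ℕ} (x : M)
    (e : Fin p → TangentSpace 𝓘(ℝ, E) x) : ℝ :=
  iteratedDeriv 2 (pushforwardNorm (E := E) f v x e) 0

end SymmetricOrbit

end

/-!
In the chart at `x` the submanifold is an immersion `F`, and the field `V_u` becomes
`(AᵀA)⁻¹Aᵀ u` with `A = dF`. Along its integral curve a transported tangent vector `w` solves
`w' = T_w u`, where `T_w` is the derivative of the orthogonal projection `P` onto the tangent spaces
in the direction of the tangential part of `w`; on tangent vectors `T` is the second fundamental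
form. Differentiating the Gram determinant twice expresses `Q_ξ(V_u)` through `T` and its derivative
`T'`. Every term is a quadratic form in `u`, so the sum over an orthonormal basis is a trace. It is
computed from what the once and twice differentiated identity `P² = P` says about `T` and `T'`,
together with the symmetry of `T` on tangent vectors. In the resulting double sum over `e_j` and the
full tangent basis, the part in which both indices belong to the frame cancels.

That the linearised equation governs the differential of the flow is Grönwall's inequality applied
to the difference between a solution and its linearisation.
-/

noncomputable section

namespace SymmetricOrbit

open Set Filter Topology

section LocalFlow

variable {E : Type*} [NormedAddCommGroup E] [NormedSpace ℝ E]

theorem gronwallBound_zero_left (K ε x : ℝ) :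
    gronwallBound 0 K ε x = ε * gronwallBound 0 K 1 x := by
  unfold gronwallBound
  split_ifs
  · ring
  · ring

theorem exists_ball_lipschitzOnWith_norm_sub_fderiv_le {W : E → E} {z₀ : E}
    (hW : ContDiffAt ℝ 2 W z₀) :
    ∃ ρ > 0, ∃ K C : NNReal, LipschitzOnWith K W (Metric.ball z₀ ρ) ∧
      ∀ z ∈ Metric.ball z₀ ρ, ∀ z' ∈ Metric.ball z₀ ρ,
        ‖W z' - W z - fderiv ℝ W z (z' - z)‖ ≤ C * ‖z' - z‖ ^ 2 := by
  obtain ⟨K, s, hs, hK⟩ := (hW.of_le one_le_two).exists_lipschitzOnWith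
  have hW' : ContDiffAt ℝ 1 (fderiv ℝ W) z₀ := hW.fderiv_right (m := 1) (by norm_num)
  obtain ⟨C, s', hs', hC⟩ := hW'.exists_lipschitzOnWith
  have hdiff : ∀ᶠ z in 𝓝 z₀, DifferentiableAt ℝ W z :=
    (hW.eventually (by simp)).mono fun z hz => hz.differentiableAt (by simp)
  obtain ⟨ρ, hρ, hball⟩ := Metric.mem_nhds_iff.mp (inter_mem (inter_mem hs hs') hdiff)
  refine ⟨ρ, hρ, K, C, hK.mono fun z hz => (hball hz).1.1, fun z hz z' hz' => ?_⟩
  have hseg : segment ℝ z z' ⊆ Metric.ball z₀ ρ := (convex_ball z₀ ρ).segment_subset hz hz'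
  have hderiv : ∀ y ∈ segment ℝ z z', ‖fderiv ℝ W y - fderiv ℝ W z‖ ≤ C * ‖z' - z‖ := by
    intro y hy
    refine (hC.norm_sub_le (hball (hseg hy)).1.2 (hball hz).1.2).trans ?_
    gcongr
    exact norm_sub_le_of_mem_segment hy
  calc ‖W z' - W z - fderiv ℝ W z (z' - z)‖ ≤ C * ‖z' - z‖ * ‖z' - z‖ :=
        Convex.norm_image_sub_le_of_norm_fderiv_le' (fun y hy => (hball (hseg hy)).2) hderiv
          (convex_segment z z') (left_mem_segment ℝ z z') (right_mem_segment ℝ z z')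
    _ = C * ‖z' - z‖ ^ 2 := by ring

/-- The linearised solution `γ + D h` satisfies the equation up to an error quadratic in `h`, so
Grönwall's inequality controls its distance to the true solution `α`. -/
theorem norm_sub_linearization_le {W : E → E} {W' : E → E →L[ℝ] E} {s : Set E}
    {K C : NNReal} (hK : LipschitzOnWith K W s)
    (hC : ∀ z ∈ s, ∀ z' ∈ s, ‖W z' - W z - W' z (z' - z)‖ ≤ C * ‖z' - z‖ ^ 2)
    {γ α : ℝ → E} {D : ℝ → E →L[ℝ] E} {h : E} {r : ℝ}
    (hγ : ∀ t ∈ Icc (0 : ℝ) 1, HasDerivAt γ (W (γ t)) t ∧ γ t ∈ s)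
    (hα : ∀ t ∈ Icc (0 : ℝ) 1, HasDerivAt α (W (α t)) t ∧ α t ∈ s)
    (hD : ∀ t ∈ Icc (0 : ℝ) 1, HasDerivAt D (W' (γ t) ∘L D t) t)
    (hDr : ∀ t ∈ Icc (0 : ℝ) 1, ‖D t h‖ ≤ r ∧ γ t + D t h ∈ s) (h₀ : α 0 = γ 0 + D 0 h) :
    ‖α 1 - γ 1 - D 1 h‖ ≤ C * r ^ 2 * gronwallBound 0 K 1 1 := by
  have hlin : ∀ t ∈ Icc (0 : ℝ) 1,
      HasDerivAt (fun t => γ t + D t h) (W (γ t) + W' (γ t) (D t h)) t := fun t ht =>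
    (hγ t ht).1.add
      (((hD t ht).clm_apply (hasDerivAt_const t h)).congr_deriv (by simp))
  have herror : ∀ t ∈ Icc (0 : ℝ) 1,
      dist (W (γ t) + W' (γ t) (D t h)) (W (γ t + D t h)) ≤ C * r ^ 2 := fun t ht =>
    calc dist (W (γ t) + W' (γ t) (D t h)) (W (γ t + D t h))
        = ‖W (γ t + D t h) - W (γ t) - W' (γ t) (γ t + D t h - γ t)‖ := by
          rw [dist_eq_norm, ← norm_neg, add_sub_cancel_left]
          congr 1
          abel
      _ ≤ C * ‖γ t + D t h - γ t‖ ^ 2 := hC _ (hγ t ht).2 _ (hDr t ht).2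
      _ ≤ C * r ^ 2 := by
          rw [add_sub_cancel_left]
          gcongr
          exact (hDr t ht).1
  have hgronwall := dist_le_of_approx_trajectories_ODE_of_mem (v := fun _ => W) (s := fun _ => s)
    (f' := fun t => W (α t)) (εf := 0) (δ := 0) (fun _ _ => hK)
    (fun t ht => (hα t ht).1.continuousAt.continuousWithinAt)
    (fun t ht => (hα t (Ico_subset_Icc_self ht)).1.hasDerivWithinAt) (by simp)
    (fun t ht => (hα t (Ico_subset_Icc_self ht)).2)
    (fun t ht => (hlin t ht).continuousAt.continuousWithinAt)
    (fun t ht => (hlin t (Ico_subset_Icc_self ht)).hasDerivWithinAt)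
    (fun t ht => herror t (Ico_subset_Icc_self ht))
    (fun t ht => (hDr t (Ico_subset_Icc_self ht)).2) (by simp [h₀]) 1 ⟨zero_le_one, le_rfl⟩
  rw [zero_add, sub_zero, gronwallBound_zero_left] at hgronwall
  simpa only [dist_eq_norm, sub_sub] using hgronwall

theorem hasFDerivAt_solution_one {W : E → E} {W' : E → E →L[ℝ] E} {s : Set E}
    (hs : IsOpen s) {K C : NNReal} (hK : LipschitzOnWith K W s)
    (hC : ∀ z ∈ s, ∀ z' ∈ s, ‖W z' - W z - W' z (z' - z)‖ ≤ C * ‖z' - z‖ ^ 2)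
    {α : E → ℝ → E} {D : ℝ → E →L[ℝ] E} {z₀ : E}
    (hα : ∀ᶠ z in 𝓝 z₀, α z 0 = z ∧
      ∀ t ∈ Icc (0 : ℝ) 1, HasDerivAt (α z) (W (α z t)) t ∧ α z t ∈ s)
    (hD₀ : D 0 = ContinuousLinearMap.id ℝ E)
    (hD : ∀ t ∈ Icc (0 : ℝ) 1, HasDerivAt D (W' (α z₀ t) ∘L D t) t) :
    HasFDerivAt (fun z => α z 1) (D 1) z₀ := by
  have hα₀ := hα.self_of_nhds
  have hαc : ContinuousOn (α z₀) (Icc 0 1) :=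
    fun t ht => (hα₀.2 t ht).1.continuousAt.continuousWithinAt
  have hDc : ContinuousOn D (Icc 0 1) := fun t ht => (hD t ht).continuousAt.continuousWithinAt
  obtain ⟨δ, hδ, hδs⟩ := (isCompact_Icc.image_of_continuousOn hαc).exists_thickening_subset_open
    hs (image_subset_iff.mpr fun t ht => (hα₀.2 t ht).2)
  obtain ⟨R, hR⟩ := isCompact_Icc.exists_bound_of_continuousOn hDc
  have hsmall : ∀ᶠ z in 𝓝 z₀, R * ‖z - z₀‖ < δ := by
    have hcont : Continuous fun z => R * ‖z - z₀‖ := by fun_prop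
    exact (hcont.tendsto' z₀ 0 (by simp)).eventually_lt_const hδ
  have hO : (fun z => α z 1 - α z₀ 1 - D 1 (z - z₀)) =O[𝓝 z₀] fun z => ‖z - z₀‖ ^ 2 := by
    refine Asymptotics.IsBigO.of_bound (C * R ^ 2 * gronwallBound 0 K 1 1) ?_
    filter_upwards [hα, hsmall] with z hz hzδ
    have hDr : ∀ t ∈ Icc (0 : ℝ) 1, ‖D t (z - z₀)‖ ≤ R * ‖z - z₀‖ := fun t ht =>
      (D t).le_of_opNorm_le (hR t ht) _
    refine (norm_sub_linearization_le hK hC hα₀.2 hz.2 hD (fun t ht => ⟨hDr t ht, hδs ?_⟩)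
      (by simp [hz.1, hα₀.1, hD₀])).trans_eq ?_
    · refine Metric.mem_thickening_iff.mpr ⟨_, mem_image_of_mem _ ht, ?_⟩
      simpa using (hDr t ht).trans_lt hzδ
    · rw [Real.norm_of_nonneg (by positivity)]
      ring
  exact .of_isLittleO (hO.trans_isLittleO
    (Asymptotics.isLittleO_pow_sub_sub z₀ one_lt_two))

/-- Rescaling time reduces every time `T`, of either sign, to `hasFDerivAt_solution_one`. -/
theorem hasFDerivAt_solution {W : E → E} {W' : E → E →L[ℝ] E} {s : Set E}
    (hs : IsOpen s) {K C : NNReal} (hK : LipschitzOnWith K W s)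
    (hC : ∀ z ∈ s, ∀ z' ∈ s, ‖W z' - W z - W' z (z' - z)‖ ≤ C * ‖z' - z‖ ^ 2)
    {α : E → ℝ → E} {D : ℝ → E →L[ℝ] E} {z₀ : E} {T : ℝ}
    (hα : ∀ᶠ z in 𝓝 z₀, α z 0 = z ∧
      ∀ t ∈ uIcc 0 T, HasDerivAt (α z) (W (α z t)) t ∧ α z t ∈ s)
    (hD₀ : D 0 = ContinuousLinearMap.id ℝ E)
    (hD : ∀ t ∈ uIcc 0 T, HasDerivAt D (W' (α z₀ t) ∘L D t) t) :
    HasFDerivAt (fun z => α z T) (D T) z₀ := by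
  have hmem : ∀ t ∈ Icc (0 : ℝ) 1, T * t ∈ uIcc 0 T := fun t ht => by
    rw [← segment_eq_uIcc, segment_eq_image]
    exact ⟨t, ht, by simp [mul_comm]⟩
  have hscale : ∀ {F : Type _} [NormedAddCommGroup F] [NormedSpace ℝ F] {c : ℝ → F} {c' : F}
      {t : ℝ}, HasDerivAt c c' (T * t) → HasDerivAt (fun t => c (T * t)) (T • c') t :=
    fun hc => hc.scomp _ (by simpa using (hasDerivAt_id _).const_mul T)
  have hone := hasFDerivAt_solution_one (W := fun z => T • W z) (W' := fun z => T • W' z)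
    (K := ‖T‖₊ * K) (C := ‖T‖₊ * C) (α := fun z t => α z (T * t)) (D := fun t => D (T * t)) hs
    ((lipschitzWith_smul T).comp_lipschitzOnWith hK)
    (fun z hz z' hz' => by
      rw [smul_apply, ← smul_sub, ← smul_sub, norm_smul, NNReal.coe_mul,
        coe_nnnorm, mul_assoc]
      gcongr
      exact hC z hz z' hz')
    (hα.mono fun z hz => ⟨by simpa using hz.1, fun t ht =>
      ⟨hscale (hz.2 _ (hmem t ht)).1, (hz.2 _ (hmem t ht)).2⟩⟩)
    (by simpa using hD₀)
    (fun t ht => (hscale (hD _ (hmem t ht))).congr_deriv (ContinuousLinearMap.smul_comp _ _ _).symm)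
  simpa only [mul_one] using hone

theorem exists_localFlow [CompleteSpace E] {W : E → E} {z₀ : E} (hW : ContDiffAt ℝ 1 W z₀)
    {U : Set E} (hU : U ∈ 𝓝 z₀) :
    ∃ ε > 0, ∃ Φ : E → ℝ → E, ∀ᶠ z in 𝓝 z₀, Φ z 0 = z ∧
      ∀ t ∈ Ioo (-ε) ε, HasDerivAt (Φ z) (W (Φ z t)) t ∧ Φ z t ∈ U := by
  obtain ⟨ε, hε, a, r, _, _, hr, hpl⟩ := IsPicardLindelof.of_contDiffAt_one hW
  obtain ⟨α, hα, hαc⟩ := (hpl 0).exists_forall_mem_closedBall_eq_hasDerivWithinAt_continuousOn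
  simp only [zero_sub, zero_add] at hα hαc
  have hball : Metric.closedBall z₀ r ∈ 𝓝 z₀ := Metric.closedBall_mem_nhds z₀ hr
  have hcont : ContinuousAt α (z₀, 0) :=
    hαc.continuousAt (prod_mem_nhds hball (Icc_mem_nhds (by simpa) hε))
  have hmemU : ∀ᶠ p in 𝓝 z₀ ×ˢ 𝓝 (0 : ℝ), α p ∈ U := by
    rw [← nhds_prod_eq]
    exact hcont.preimage_mem_nhds (by rwa [(hα z₀ (mem_of_mem_nhds hball)).1])
  obtain ⟨N, hN, I, hI, hNI⟩ := mem_prod_iff.mp hmemU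
  obtain ⟨δ, hδ, hδI⟩ := Metric.mem_nhds_iff.mp hI
  rw [Real.ball_eq_Ioo, zero_sub, zero_add] at hδI
  refine ⟨min ε δ, lt_min hε hδ, fun z t => α (z, t), ?_⟩
  filter_upwards [hball, hN] with z hzr hzN
  refine ⟨(hα z hzr).1, fun t ht => ⟨?_, hNI (mk_mem_prod hzN (hδI ?_))⟩⟩
  · have htε : t ∈ Ioo (-ε) ε := Ioo_subset_Ioo (neg_le_neg (min_le_left ε δ)) (min_le_left ε δ) ht
    exact ((hα z hzr).2 t (Ioo_subset_Icc_self htε)).hasDerivAt (Icc_mem_nhds htε.1 htε.2)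
  · exact Ioo_subset_Ioo (neg_le_neg (min_le_right ε δ)) (min_le_right ε δ) ht

/-- The vector field on `E × (E →L[ℝ] E)` whose integral curves `(γ, D)` consist of an integral
curve `γ` of `W` and a solution `D` of the equation of first variation along `γ`. -/
def variationField (W : E → E) (p : E × (E →L[ℝ] E)) : E × (E →L[ℝ] E) :=
  (W p.1, fderiv ℝ W p.1 ∘L p.2)

theorem contDiffAt_variationField {W : E → E} {p : E × (E →L[ℝ] E)}
    (hW : ContDiffAt ℝ 2 W p.1) : ContDiffAt ℝ 1 (variationField W) p := by
  have hW' : ContDiffAt ℝ 1 (fderiv ℝ W) p.1 := hW.fderiv_right (m := 1) (by norm_num)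
  exact ((hW.of_le one_le_two).comp p contDiffAt_fst).prodMk
    ((hW'.comp p contDiffAt_fst).clm_comp contDiffAt_snd)

theorem exists_localFlow_hasFDerivAt [CompleteSpace E] {W : E → E} {z₀ : E}
    (hW : ContDiffAt ℝ 2 W z₀) {U : Set E} (hU : U ∈ 𝓝 z₀) :
    ∃ ε > 0, ∃ (Φ : E → ℝ → E) (D : ℝ → E →L[ℝ] E),
      (∀ᶠ z in 𝓝 z₀, Φ z 0 = z ∧
        ∀ t ∈ Ioo (-ε) ε, HasDerivAt (Φ z) (W (Φ z t)) t ∧ Φ z t ∈ U) ∧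
      D 0 = ContinuousLinearMap.id ℝ E ∧
      ∀ t ∈ Ioo (-ε) ε, HasDerivAt D (fderiv ℝ W (Φ z₀ t) ∘L D t) t ∧
        HasFDerivAt (fun z => Φ z t) (D t) z₀ := by
  obtain ⟨ρ, hρ, K, C, hK, hC⟩ := exists_ball_lipschitzOnWith_norm_sub_fderiv_le hW
  let p₀ : E × (E →L[ℝ] E) := (z₀, ContinuousLinearMap.id ℝ E)
  obtain ⟨ε, hε, Ψ, hΨ⟩ := exists_localFlow (contDiffAt_variationField (p := p₀) hW)
    (prod_mem_nhds (inter_mem hU (Metric.ball_mem_nhds z₀ hρ)) univ_mem)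
  have hflow : ∀ᶠ z in 𝓝 z₀, (Ψ (z, p₀.2) 0).1 = z ∧ ∀ t ∈ Ioo (-ε) ε,
      HasDerivAt (fun t => (Ψ (z, p₀.2) t).1) (W (Ψ (z, p₀.2) t).1) t ∧
        (Ψ (z, p₀.2) t).1 ∈ U ∩ Metric.ball z₀ ρ :=
    ((Continuous.prodMk_left p₀.2).continuousAt.eventually hΨ).mono fun z hz =>
      ⟨congrArg Prod.fst hz.1, fun t ht => ⟨(hz.2 t ht).1.fst, (hz.2 t ht).2.1⟩⟩
  have hD : ∀ t ∈ Ioo (-ε) ε,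
      HasDerivAt (fun t => (Ψ p₀ t).2) (fderiv ℝ W (Ψ p₀ t).1 ∘L (Ψ p₀ t).2) t :=
    fun t ht => (hΨ.self_of_nhds.2 t ht).1.snd
  have hD₀ : (Ψ p₀ 0).2 = ContinuousLinearMap.id ℝ E := congrArg Prod.snd hΨ.self_of_nhds.1
  refine ⟨ε, hε, fun z t => (Ψ (z, p₀.2) t).1, fun t => (Ψ p₀ t).2,
    hflow.mono fun z hz => ⟨hz.1, fun t ht => ⟨(hz.2 t ht).1, (hz.2 t ht).2.1⟩⟩, hD₀,
    fun T hT => ⟨hD T hT, ?_⟩⟩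
  have hsub : uIcc 0 T ⊆ Ioo (-ε) ε :=
    ordConnected_Ioo.uIcc_subset ⟨neg_lt_zero.mpr hε, hε⟩ hT
  exact hasFDerivAt_solution Metric.isOpen_ball hK hC
    (hflow.mono fun z hz => ⟨hz.1, fun t ht => ⟨(hz.2 t (hsub ht)).1, (hz.2 t (hsub ht)).2.2⟩⟩)
    hD₀ fun t ht => hD t (hsub ht)

theorem contDiffAt_succ_of_hasDerivAt {Z : E → E} {c : ℝ → E} {t₀ : ℝ} (n : ℕ)
    (hZ : ContDiffAt ℝ n Z (c t₀)) (hc : ∀ᶠ t in 𝓝 t₀, HasDerivAt c (Z (c t)) t) :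
    ContDiffAt ℝ (n + 1 : ℕ) c t₀ := by
  have hsucc : ∀ m : ℕ, m ≤ n → ContDiffAt ℝ m c t₀ → ContDiffAt ℝ (m + 1 : ℕ) c t₀ := by
    intro m hm hcm
    have hZc : ContDiffAt ℝ m (fun t => Z (c t)) t₀ := (hZ.of_le (by exact_mod_cast hm)).comp t₀ hcm
    rw [Nat.cast_add, Nat.cast_one, contDiffAt_succ_iff_hasFDerivAt]
    exact ⟨fun t => ContinuousLinearMap.toSpanSingleton ℝ (Z (c t)),
      ⟨_, hc, fun t ht => HasDerivAt.hasFDerivAt ht⟩,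
      (ContinuousLinearMap.toSpanSingletonCLE (𝕜 := ℝ) (E := E)).contDiff.contDiffAt.comp t₀ hZc⟩
  suffices ∀ m : ℕ, m ≤ n + 1 → ContDiffAt ℝ m c t₀ from this _ le_rfl
  intro m
  induction m with
  | zero =>
    intro _
    rw [Nat.cast_zero, contDiffAt_zero]
    exact ⟨_, hc, fun t ht => (HasDerivAt.continuousAt ht).continuousWithinAt⟩
  | succ m ih => exact fun hm => hsucc m (by omega) (ih (by omega))

end LocalFlow

section Determinant

open scoped Matrix.Norms.Operator

theorem hasDerivAt_matrix_iff {m : Type*} [Finite m] {G : ℝ → Matrix m m ℝ} {G' : Matrix m m ℝ}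
    {t : ℝ} : HasDerivAt G G' t ↔ ∀ i j, HasDerivAt (fun t => G t i j) (G' i j) t :=
  have := Fintype.ofFinite m
  (hasDerivAt_pi (φ := G) (φ' := G')).trans (forall_congr' fun _ => hasDerivAt_pi)

theorem hasDerivAt_gram {m : Type*} [Finite m] {V : Type*} [NormedAddCommGroup V]
    [InnerProductSpace ℝ V] {w : m → ℝ → V} {w' : m → V} {t : ℝ}
    (hw : ∀ i, HasDerivAt (w i) (w' i) t) :
    HasDerivAt (fun t => Matrix.gram ℝ fun i => w i t)
      (Matrix.of fun i j => ⟪w i t, w' j⟫_ℝ + ⟪w' i, w j t⟫_ℝ) t :=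
  hasDerivAt_matrix_iff.mpr fun i j => (hw i).inner ℝ (hw j)

variable {m : Type*} [Fintype m] [DecidableEq m]

/-- Jacobi's formula. -/
theorem hasDerivAt_det {G : ℝ → Matrix m m ℝ} {G' : Matrix m m ℝ} {t : ℝ}
    (hG : HasDerivAt G G' t) :
    HasDerivAt (fun t => (G t).det) ((G t).adjugate * G').trace t := by
  let detRows : ContinuousMultilinearMap ℝ (fun _ : m => m → ℝ) ℝ :=
    { Matrix.detRowAlternating.toMultilinearMap with cont := continuous_id.matrix_det }
  refine ((detRows.hasFDerivAt (G t)).comp_hasDerivAt t hG).congr_deriv ?_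
  have hrow : ∀ i, ((G t).updateRow i (G' i)).det = (G' * (G t).adjugate) i i := fun i => by
    rw [← Matrix.cramer_transpose_apply, Matrix.cramer_eq_adjugate_mulVec,
      ← Matrix.adjugate_transpose, Matrix.mulVec_transpose]
    rfl
  rw [Matrix.trace_mul_comm]
  exact (detRows.linearDeriv_apply _ _).trans (Finset.sum_congr rfl fun i _ => hrow i)

theorem hasDerivAt_matrix_inv {G : ℝ → Matrix m m ℝ} {G' : Matrix m m ℝ} {t : ℝ}
    (hG : HasDerivAt G G' t) (ht : IsUnit (G t)) :
    HasDerivAt (fun t => (G t)⁻¹) (-((G t)⁻¹ * G' * (G t)⁻¹)) t := by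
  obtain ⟨u, hu⟩ := ht
  have hinv := hasFDerivAt_ringInverse (𝕜 := ℝ) u
  rw [hu] at hinv
  simp only [Matrix.nonsing_inv_eq_ringInverse]
  exact (hinv.comp_hasDerivAt t hG).congr_deriv (by simp [← hu])

theorem hasDerivAt_sqrt_det {G : ℝ → Matrix m m ℝ} {G' : Matrix m m ℝ} {t : ℝ}
    (hG : HasDerivAt G G' t) (ht : 0 < (G t).det) :
    HasDerivAt (fun t => √(G t).det) (√(G t).det * ((G t)⁻¹ * G').trace / 2) t := by
  refine ((hasDerivAt_det hG).sqrt ht.ne').congr_deriv ?_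
  have hadj : (G t).adjugate = (G t).det • (G t)⁻¹ := by
    rw [Matrix.inv_def, smul_smul, Ring.inverse_eq_inv', mul_inv_cancel₀ ht.ne', one_smul]
  rw [hadj, Matrix.smul_mul, Matrix.trace_smul, smul_eq_mul]
  nth_rewrite 1 [← Real.mul_self_sqrt ht.le]
  field_simp [(Real.sqrt_pos.mpr ht).ne']

theorem iteratedDeriv_two_sqrt_det {G G' : ℝ → Matrix m m ℝ} {G'' : Matrix m m ℝ} {t₀ : ℝ}
    (hG : ∀ᶠ t in 𝓝 t₀, HasDerivAt G (G' t) t) (hG' : HasDerivAt G' G'' t₀) (h₀ : G t₀ = 1) :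
    iteratedDeriv 2 (fun t => √(G t).det) t₀ =
      (G''.trace - (G' t₀ * G' t₀).trace) / 2 + (G' t₀).trace ^ 2 / 4 := by
  have hG₀ := hG.self_of_nhds
  have hpos : ∀ᶠ t in 𝓝 t₀, 0 < (G t).det :=
    continuousAt_const.eventually_lt (hasDerivAt_det hG₀).continuousAt (by simp [h₀])
  have hderiv : deriv (fun t => √(G t).det) =ᶠ[𝓝 t₀]
      fun t => √(G t).det * ((G t)⁻¹ * G' t).trace / 2 := by
    filter_upwards [hG, hpos] with t ht htpos
    exact (hasDerivAt_sqrt_det ht htpos).deriv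
  have htrace : HasDerivAt (fun t => ((G t)⁻¹ * G' t).trace)
      (G''.trace - (G' t₀ * G' t₀).trace) t₀ := by
    have hprod := (hasDerivAt_matrix_inv hG₀ (h₀ ▸ isUnit_one)).mul hG'
    have hentry := hasDerivAt_matrix_iff.mp
      (hprod.congr_deriv (g' := G'' - G' t₀ * G' t₀) (by simp [h₀, neg_add_eq_sub]))
    rw [← Matrix.trace_sub]
    exact HasDerivAt.fun_sum fun i _ => hentry i i
  rw [iteratedDeriv_succ, iteratedDeriv_one, hderiv.deriv_eq,
    (((hasDerivAt_sqrt_det hG₀ hpos.self_of_nhds).fun_mul htrace).div_const 2).deriv]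
  simp only [h₀, inv_one, Matrix.det_one, Real.sqrt_one, one_mul]
  ring

variable {V : Type*} [NormedAddCommGroup V] [InnerProductSpace ℝ V]

theorem contDiffAt_sqrt_det_gram {w : m → ℝ → V} {t₀ : ℝ} {n : WithTop ℕ∞}
    (hw : ∀ i, ContDiffAt ℝ n (w i) t₀) (horth : Orthonormal ℝ fun i => w i t₀) :
    ContDiffAt ℝ n (fun t => √(Matrix.gram ℝ fun i => w i t).det) t₀ := by
  have hdet : ContDiffAt ℝ n (fun t => (Matrix.gram ℝ fun i => w i t).det) t₀ := by
    simp only [Matrix.det_apply, Matrix.gram_apply]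
    exact ContDiffAt.sum fun σ _ =>
      (contDiffAt_prod fun i _ => (hw (σ i)).inner ℝ (hw i)).const_smul _
  exact hdet.sqrt (by simp [Matrix.gram_eq_one_iff_orthonormal.mpr horth])

theorem iteratedDeriv_two_sqrt_det_gram {w w' : m → ℝ → V} {w'' : m → V} {t₀ : ℝ}
    (hw : ∀ᶠ t in 𝓝 t₀, ∀ i, HasDerivAt (w i) (w' i t) t)
    (hw' : ∀ i, HasDerivAt (w' i) (w'' i) t₀) (horth : Orthonormal ℝ fun i => w i t₀)
    (hsymm : ∀ i j, ⟪w i t₀, w' j t₀⟫_ℝ = ⟪w' i t₀, w j t₀⟫_ℝ) :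
    iteratedDeriv 2 (fun t => √(Matrix.gram ℝ fun i => w i t).det) t₀ =
      ∑ j, (⟪w'' j, w j t₀⟫_ℝ + ‖w' j t₀‖ ^ 2) - 2 * ∑ i, ∑ j, ⟪w' i t₀, w j t₀⟫_ℝ ^ 2 +
        (∑ j, ⟪w' j t₀, w j t₀⟫_ℝ) ^ 2 := by
  have hgram' : HasDerivAt
      (fun t => Matrix.of fun i j => ⟪w i t, w' j t⟫_ℝ + ⟪w' i t, w j t⟫_ℝ)
      (Matrix.of fun i j => ⟪w i t₀, w'' j⟫_ℝ + ⟪w' i t₀, w' j t₀⟫_ℝ +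
        (⟪w' i t₀, w' j t₀⟫_ℝ + ⟪w'' i, w j t₀⟫_ℝ)) t₀ :=
    hasDerivAt_matrix_iff.mpr fun i j =>
      ((hw.self_of_nhds i).inner ℝ (hw' j)).add ((hw' i).inner ℝ (hw.self_of_nhds j))
  rw [iteratedDeriv_two_sqrt_det (hw.mono fun t ht => hasDerivAt_gram ht) hgram'
    (Matrix.gram_eq_one_iff_orthonormal.mpr horth)]
  have htrace_sq : ∀ i j, 2 * ⟪w' i t₀, w j t₀⟫_ℝ * (2 * ⟪w' j t₀, w i t₀⟫_ℝ) =
      4 * ⟪w' i t₀, w j t₀⟫_ℝ ^ 2 := fun i j => by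
    rw [← hsymm j i, real_inner_comm]
    ring
  have htrace'' : ∀ j, ⟪w j t₀, w'' j⟫_ℝ + ⟪w' j t₀, w' j t₀⟫_ℝ +
      (⟪w' j t₀, w' j t₀⟫_ℝ + ⟪w'' j, w j t₀⟫_ℝ) =
        2 * (⟪w'' j, w j t₀⟫_ℝ + ‖w' j t₀‖ ^ 2) := fun j => by
    rw [real_inner_self_eq_norm_sq, real_inner_comm]
    ring
  simp only [Matrix.trace, Matrix.diag_apply, Matrix.mul_apply, Matrix.of_apply,
    htrace'', hsymm, ← two_mul, htrace_sq, ← Finset.mul_sum]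
  ring

end Determinant

section Trace

variable {V : Type*} [NormedAddCommGroup V] [InnerProductSpace ℝ V] [FiniteDimensional ℝ V]
  {W : Submodule ℝ V} {ι κ : Type*} [Fintype ι] [Fintype κ]

theorem sum_inner_comp_comm (b : OrthonormalBasis ι ℝ V) (A B : V →ₗ[ℝ] V) :
    ∑ i, ⟪b i, A (B (b i))⟫_ℝ = ∑ i, ⟪b i, B (A (b i))⟫_ℝ := by
  have htrace := LinearMap.trace_comp_comm' B A
  rwa [LinearMap.trace_eq_sum_inner _ b, LinearMap.trace_eq_sum_inner _ b] at htrace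

theorem sum_inner_comp_starProjection (b : OrthonormalBasis ι ℝ V) (g : OrthonormalBasis κ ℝ W)
    (R : V →ₗ[ℝ] V) :
    ∑ i, ⟪b i, R (W.starProjection (b i))⟫_ℝ = ∑ a, ⟪(g a : V), R (g a)⟫_ℝ := by
  have htrace := LinearMap.trace_comp_comm' (W.orthogonalProjectionOnto : V →ₗ[ℝ] W)
    (R ∘ₗ W.subtype)
  rw [LinearMap.trace_eq_sum_inner _ b, LinearMap.trace_eq_sum_inner _ g] at htrace
  simpa using htrace

variable {S : V →ₗ[ℝ] V}

/-- This is `tr (S P S) = tr (S² P)` for the projection `P` onto `W`. -/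
theorem sum_inner_comp_starProjection_comp (hS : S.IsSymmetric) (b : OrthonormalBasis ι ℝ V)
    (g : OrthonormalBasis κ ℝ W) :
    ∑ i, ⟪b i, S (W.starProjection (S (b i)))⟫_ℝ = ∑ a, ‖S (g a)‖ ^ 2 :=
  calc ∑ i, ⟪b i, S (W.starProjection (S (b i)))⟫_ℝ
      = ∑ i, ⟪b i, (S ∘ₗ S) (W.starProjection (b i))⟫_ℝ :=
        sum_inner_comp_comm b (S ∘ₗ W.starProjection.toLinearMap) S
    _ = ∑ a, ⟪(g a : V), (S ∘ₗ S) (g a)⟫_ℝ := sum_inner_comp_starProjection b g _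
    _ = ∑ a, ‖S (g a)‖ ^ 2 := Finset.sum_congr rfl fun a _ => by
        rw [LinearMap.comp_apply, ← hS, real_inner_self_eq_norm_sq]

/-- The hypothesis `hSW` says that `S` exchanges `W` and its orthogonal complement; both blocks
contribute equally. -/
theorem sum_norm_sq_eq_two_mul_sum_norm_sq (hS : S.IsSymmetric)
    (hSW : ∀ v, S (W.starProjection v) + W.starProjection (S v) = S v)
    (b : OrthonormalBasis ι ℝ V) (g : OrthonormalBasis κ ℝ W) :
    ∑ i, ‖S (b i)‖ ^ 2 = 2 * ∑ a, ‖S (g a)‖ ^ 2 := by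
  have hsplit : ∀ v, ‖S v‖ ^ 2 =
      ⟪v, (S ∘ₗ S) (W.starProjection v)⟫_ℝ + ⟪v, S (W.starProjection (S v))⟫_ℝ := fun v => by
    rw [← real_inner_self_eq_norm_sq, hS, ← inner_add_right, LinearMap.comp_apply, ← map_add, hSW]
  have hdiag : ∑ i, ⟪b i, (S ∘ₗ S) (W.starProjection (b i))⟫_ℝ = ∑ a, ‖S (g a)‖ ^ 2 :=
    (sum_inner_comp_starProjection b g _).trans (Finset.sum_congr rfl fun a _ => by
      rw [LinearMap.comp_apply, ← hS, real_inner_self_eq_norm_sq])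
  rw [Finset.sum_congr rfl fun i _ => hsplit (b i), Finset.sum_add_distrib, hdiag,
    sum_inner_comp_starProjection_comp hS b g, two_mul]

end Trace

section TangentProjectionDeriv

variable {V : Type*} [NormedAddCommGroup V] [InnerProductSpace ℝ V]
  {W : Submodule ℝ V} {T : V →L[ℝ] V →L[ℝ] V} {T' : V →L[ℝ] V →L[ℝ] V →L[ℝ] V}
  {ι κ : Type*} [Fintype ι] [Fintype κ]

/-- The algebraic properties of the derivative `T v` of the orthogonal projection onto the tangent
spaces of a submanifold, in the direction of the tangential part of `v`, at a point with tangent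
space `W`. On `W` the bilinear map `T` is the second fundamental form. -/
structure IsTangentProjectionDeriv (W : Submodule ℝ V) [W.HasOrthogonalProjection]
    (T : V →L[ℝ] V →L[ℝ] V) : Prop where
  isSymmetric : ∀ v, (T v).toLinearMap.IsSymmetric
  apply_starProjection_add : ∀ v w, T v (W.starProjection w) + W.starProjection (T v w) = T v w
  starProjection_apply : ∀ v, T (W.starProjection v) = T v
  apply_comm : ∀ X ∈ W, ∀ Y ∈ W, T X Y = T Y X

/-- The second derivative of the volume of an orthonormal frame `e` of tangent vectors moved by the
flow of the tangential part of the constant field `u`, in terms of the derivative `T` of the tangent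
projection and the derivative `T'` of `T`, see `iteratedDeriv_two_sqrt_det_gram_fderiv`. -/
def frameSecondVariation (T : V →L[ℝ] V →L[ℝ] V) (T' : V →L[ℝ] V →L[ℝ] V →L[ℝ] V)
    (e : κ → V) (u : V) : ℝ :=
  ∑ j, (⟪T' u (e j) u + T (T (e j) u) u, e j⟫_ℝ + ‖T (e j) u‖ ^ 2) -
    2 * ∑ i, ∑ j, ⟪T (e i) u, e j⟫_ℝ ^ 2 + (∑ j, ⟪T (e j) u, e j⟫_ℝ) ^ 2

namespace IsTangentProjectionDeriv

variable [FiniteDimensional ℝ V]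

theorem sum_inner_deriv_apply (hT : IsTangentProjectionDeriv W T)
    (hT' : ∀ u v, (T' u v).toLinearMap.IsSymmetric)
    (hT'W : ∀ u, T' (W.starProjection u) = T' u)
    (hT'add : ∀ u v w, T' u v (W.starProjection w) + T v (T u w) + (T u (T v w) +
      W.starProjection (T' u v w)) = T' u v w)
    (b : OrthonormalBasis ι ℝ V) (g : OrthonormalBasis κ ℝ W) {e : V} (he : e ∈ W) :
    ∑ i, ⟪T' (b i) e (b i), e⟫_ℝ =
      -∑ a, (‖T e (g a)‖ ^ 2 + ⟪T e e, T (g a) (g a)⟫_ℝ) := by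
  have htangential : ∀ X ∈ W,
      ⟪X, T' X e e⟫_ℝ = -(‖T e X‖ ^ 2 + ⟪T e e, T X X⟫_ℝ) := fun X hX => by
    have hadd := congrArg (fun v => ⟪X, v⟫_ℝ) (hT'add X e e)
    simp only [Submodule.starProjection_eq_self_iff.mpr he, inner_add_right,
      ← Submodule.inner_starProjection_left_eq_right,
      Submodule.starProjection_eq_self_iff.mpr hX] at hadd
    have hcross : ⟪X, T e (T X e)⟫_ℝ = ‖T e X‖ ^ 2 := by
      rw [← real_inner_self_eq_norm_sq, hT.apply_comm X hX e he]
      exact (hT.isSymmetric e X (T e X)).symm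
    have hdiag : ⟪X, T X (T e e)⟫_ℝ = ⟪T e e, T X X⟫_ℝ :=
      (hT.isSymmetric X X (T e e)).symm.trans (real_inner_comm _ _)
    linarith
  let R : V →ₗ[ℝ] V := ((T'.flip e).flip e).toLinearMap
  calc ∑ i, ⟪T' (b i) e (b i), e⟫_ℝ = ∑ i, ⟪b i, R (W.starProjection (b i))⟫_ℝ :=
        Finset.sum_congr rfl fun i _ => by
          refine (hT' (b i) e (b i) e).trans ?_
          rw [← hT'W]
          rfl
    _ = ∑ a, ⟪(g a : V), R (g a)⟫_ℝ := sum_inner_comp_starProjection b g R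
    _ = _ := by
        rw [← Finset.sum_neg_distrib]
        exact Finset.sum_congr rfl fun a _ => htangential _ (g a).2

theorem sum_inner_apply_apply (hT : IsTangentProjectionDeriv W T) (b : OrthonormalBasis ι ℝ V)
    (g : OrthonormalBasis κ ℝ W) {e : V} (he : e ∈ W) :
    ∑ i, ⟪T (T e (b i)) (b i), e⟫_ℝ = ∑ a, ‖T e (g a)‖ ^ 2 := by
  refine (Finset.sum_congr rfl fun i _ => ?_).trans
    (sum_inner_comp_starProjection_comp (hT.isSymmetric e) b g)
  refine (hT.isSymmetric (T e (b i)) (b i) e).trans ?_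
  rw [ContinuousLinearMap.coe_coe, ← hT.starProjection_apply,
    hT.apply_comm _ (Submodule.starProjection_apply_mem W _) e he]
  rfl

theorem sum_norm_apply_sq (hT : IsTangentProjectionDeriv W T) (b : OrthonormalBasis ι ℝ V)
    (g : OrthonormalBasis κ ℝ W) (e : V) :
    ∑ i, ‖T e (b i)‖ ^ 2 = 2 * ∑ a, ‖T e (g a)‖ ^ 2 :=
  sum_norm_sq_eq_two_mul_sum_norm_sq (hT.isSymmetric e) (hT.apply_starProjection_add e) b g

theorem sum_inner_apply_mul_inner_apply (hT : IsTangentProjectionDeriv W T)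
    (b : OrthonormalBasis ι ℝ V) (v₁ v₂ w₁ w₂ : V) :
    ∑ i, ⟪T v₁ (b i), v₂⟫_ℝ * ⟪T w₁ (b i), w₂⟫_ℝ = ⟪T v₁ v₂, T w₁ w₂⟫_ℝ := by
  rw [← b.sum_inner_mul_inner]
  refine Finset.sum_congr rfl fun i _ => congrArg₂ _ ?_ (hT.isSymmetric w₁ (b i) w₂)
  exact (hT.isSymmetric v₁ (b i) v₂).trans (real_inner_comm _ _)

theorem sum_frameSecondVariation {κ₁ κ₂ : Type*} [Fintype κ₁] [Fintype κ₂]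
    (hT : IsTangentProjectionDeriv W T)
    (hT' : ∀ u v, (T' u v).toLinearMap.IsSymmetric)
    (hT'W : ∀ u, T' (W.starProjection u) = T' u)
    (hT'add : ∀ u v w, T' u v (W.starProjection w) + T v (T u w) + (T u (T v w) +
      W.starProjection (T' u v w)) = T' u v w)
    (b : OrthonormalBasis ι ℝ V) {e : κ₁ → V} {n : κ₂ → V}
    (g : OrthonormalBasis (κ₁ ⊕ κ₂) ℝ W) (hg : ∀ a, (g a : V) = Sum.elim e n a) :
    ∑ i, frameSecondVariation T T' e (b i) =
      ∑ j, ∑ k, (2 * ‖T (e j) (n k)‖ ^ 2 - ⟪T (e j) (e j), T (n k) (n k)⟫_ℝ) := by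
  have he : ∀ j, e j ∈ W := fun j => by simpa only [hg, Sum.elim_inl] using (g (.inl j)).2
  have hdiag : ∀ j, ∑ i, (⟪T' (b i) (e j) (b i) + T (T (e j) (b i)) (b i), e j⟫_ℝ +
      ‖T (e j) (b i)‖ ^ 2) =
        ∑ a, (2 * ‖T (e j) (g a)‖ ^ 2 - ⟪T (e j) (e j), T (g a) (g a)⟫_ℝ) := fun j => by
    simp only [inner_add_left, Finset.sum_add_distrib, Finset.sum_sub_distrib, ← Finset.mul_sum,
      hT.sum_inner_deriv_apply hT' hT'W hT'add b g (he j), hT.sum_inner_apply_apply b g (he j),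
      hT.sum_norm_apply_sq b g]
    ring
  have hgram : ∀ j k, ∑ i, ⟪T (e j) (b i), e k⟫_ℝ ^ 2 = ‖T (e j) (e k)‖ ^ 2 := fun j k => by
    simp only [sq, hT.sum_inner_apply_mul_inner_apply, real_inner_self_eq_norm_mul_norm]
  have hmean : ∑ i, (∑ j, ⟪T (e j) (b i), e j⟫_ℝ) ^ 2 =
      ∑ j, ∑ k, ⟪T (e j) (e j), T (e k) (e k)⟫_ℝ := by
    simp only [sq, Finset.sum_mul_sum, ← hT.sum_inner_apply_mul_inner_apply b]
    rw [Finset.sum_comm]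
    exact Finset.sum_congr rfl fun j _ => Finset.sum_comm
  have hexchange : ∑ i, ∑ j, ∑ k, ⟪T (e j) (b i), e k⟫_ℝ ^ 2 = ∑ j, ∑ k, ‖T (e j) (e k)‖ ^ 2 := by
    simp only [← hgram]
    rw [Finset.sum_comm]
    exact Finset.sum_congr rfl fun j _ => Finset.sum_comm
  simp only [frameSecondVariation, Finset.sum_add_distrib (s := (Finset.univ : Finset ι)),
    Finset.sum_sub_distrib (s := (Finset.univ : Finset ι)), ← Finset.mul_sum, hmean, hexchange]
  rw [Finset.sum_comm, Finset.sum_congr rfl fun j _ => hdiag j]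
  simp only [hg, Fintype.sum_sum_type, Sum.elim_inl, Sum.elim_inr, Finset.sum_add_distrib,
    Finset.sum_sub_distrib, Finset.mul_sum]
  ring

end IsTangentProjectionDeriv

end TangentProjectionDeriv

section LeftInverse

variable {V : Type*} [NormedAddCommGroup V] [InnerProductSpace ℝ V]
  {E : Type*} [NormedAddCommGroup E] [NormedSpace ℝ E]

/-- The transpose of a linear map into `V`, where `V` is identified with its dual. Unlike the
adjoint it needs no inner product on the domain. -/
def transpose : (E →L[ℝ] V) →L[ℝ] V →L[ℝ] E →L[ℝ] ℝ :=
  ((ContinuousLinearMap.compL ℝ V (V →L[ℝ] ℝ) (E →L[ℝ] ℝ)).flip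
    (isBoundedBilinearMap_inner (𝕜 := ℝ) (E := V)).toContinuousLinearMap) ∘L
      (ContinuousLinearMap.compL ℝ E V ℝ).flip

theorem transpose_apply (A : E →L[ℝ] V) (v : V) (X : E) : transpose A v X = ⟪v, A X⟫_ℝ := rfl

/-- The left inverse `(Aᵀ A)⁻¹ Aᵀ` of an injective linear map `A`: it depends smoothly on `A`, and
`A` composed with it is the orthogonal projection onto the range of `A`. -/
def leftInverse (A : E →L[ℝ] V) : V →L[ℝ] E :=
  (transpose A ∘L A).inverse ∘L transpose A

variable [FiniteDimensional ℝ E] {A : E →L[ℝ] V}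

theorem isInvertible_transpose_comp_self (hA : Function.Injective A) :
    (transpose A ∘L A).IsInvertible := by
  have hinj : Function.Injective (transpose A ∘L A) := by
    refine (injective_iff_map_eq_zero _).mpr fun X hX => hA ?_
    have hnorm : transpose A (A X) X = 0 := congrArg (fun ℓ : E →L[ℝ] ℝ => ℓ X) hX
    rw [transpose_apply, inner_self_eq_zero] at hnorm
    rw [hnorm, map_zero]
  have hdim : Module.finrank ℝ E = Module.finrank ℝ (E →L[ℝ] ℝ) := by
    rw [← Subspace.dual_finrank_eq (K := ℝ) (V := E)]
    exact LinearEquiv.finrank_eq LinearMap.toContinuousLinearMap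
  exact ⟨((transpose A ∘L A).toLinearMap.linearEquivOfInjective hinj hdim).toContinuousLinearEquiv,
    rfl⟩

theorem leftInverse_apply_apply (hA : Function.Injective A) (X : E) :
    leftInverse A (A X) = X :=
  (isInvertible_transpose_comp_self hA).inverse_apply_self X

theorem apply_leftInverse (hA : Function.Injective A) (v : V) :
    A (leftInverse A v) = A.range.starProjection v := by
  have htranspose : transpose A (A (leftInverse A v)) = transpose A v :=
    (isInvertible_transpose_comp_self hA).self_apply_inverse (transpose A v)
  refine (Submodule.eq_starProjection_of_mem_of_inner_eq_zero
    (LinearMap.mem_range_self A.toLinearMap _) ?_).symm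
  rintro _ ⟨X, rfl⟩
  rw [inner_sub_left, sub_eq_zero]
  exact congrArg (fun ℓ : E →L[ℝ] ℝ => ℓ X) htranspose.symm

theorem leftInverse_starProjection (hA : Function.Injective A) (v : V) :
    leftInverse A (A.range.starProjection v) = leftInverse A v := by
  rw [← apply_leftInverse hA, leftInverse_apply_apply hA]

theorem contDiffAt_leftInverse {n : WithTop ℕ∞} (hA : Function.Injective A) :
    ContDiffAt ℝ n leftInverse A := by
  have htranspose : ContDiffAt ℝ n (fun A : E →L[ℝ] V => transpose A) A := by fun_prop
  have hcomp : ContDiffAt ℝ n (fun A : E →L[ℝ] V => transpose A ∘L A) A :=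
    htranspose.clm_comp contDiffAt_id
  obtain ⟨e, he⟩ := isInvertible_transpose_comp_self hA
  have hinverse : ContDiffAt ℝ n ContinuousLinearMap.inverse (transpose A ∘L A) :=
    he ▸ contDiffAt_map_inverse e
  exact (ContDiffAt.comp (f := fun A : E →L[ℝ] V => transpose A ∘L A) A hinverse hcomp).clm_comp
    htranspose

end LeftInverse

section Differentiation

variable {V : Type*} [NormedAddCommGroup V] [InnerProductSpace ℝ V]
  {E G H K : Type*} [NormedAddCommGroup E] [NormedSpace ℝ E] [NormedAddCommGroup G]
  [NormedSpace ℝ G] [NormedAddCommGroup H] [NormedSpace ℝ H] [NormedAddCommGroup K]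
  [NormedSpace ℝ K] {z₀ : E}

theorem isSymmetric_fderiv_apply {Q : E → V →L[ℝ] V} (hQ : DifferentiableAt ℝ Q z₀)
    (hsymm : ∀ᶠ z in 𝓝 z₀, (Q z).toLinearMap.IsSymmetric) (X : E) :
    (fderiv ℝ Q z₀ X).toLinearMap.IsSymmetric := fun v w => by
  have hderiv : ∀ v, HasFDerivAt (fun z => Q z v) ((fderiv ℝ Q z₀).flip v) z₀ := fun v =>
    (hQ.hasFDerivAt.clm_apply (hasFDerivAt_const v z₀)).congr_fderiv (by ext; simp)
  have hleft := (hderiv v).inner ℝ (hasFDerivAt_const w z₀)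
  have hright := (hasFDerivAt_const v z₀).inner ℝ (hderiv w)
  have heq := hleft.unique (hright.congr_of_eventuallyEq (hsymm.mono fun z hz => hz v w))
  simpa using congrArg (fun ℓ : E →L[ℝ] ℝ => ℓ X) heq

theorem fderiv_comp_apply {Q : E → H →L[ℝ] K} {R : E → G →L[ℝ] H}
    (hQ : DifferentiableAt ℝ Q z₀) (hR : DifferentiableAt ℝ R z₀) (X : E) (v : G) :
    fderiv ℝ (fun z => Q z ∘L R z) z₀ X v =
      fderiv ℝ Q z₀ X (R z₀ v) + Q z₀ (fderiv ℝ R z₀ X v) := by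
  rw [fderiv_clm_comp hQ hR]
  simp [add_comm]

theorem fderiv_apply_const {Q : E → H →L[ℝ] K} (hQ : DifferentiableAt ℝ Q z₀) (v : H) (X : E) :
    fderiv ℝ (fun z => Q z v) z₀ X = fderiv ℝ Q z₀ X v := by
  rw [fderiv_clm_apply hQ (differentiableAt_const v)]
  simp

end Differentiation

section Immersion

variable {V : Type*} [NormedAddCommGroup V] [InnerProductSpace ℝ V]
  {E : Type*} [NormedAddCommGroup E] [NormedSpace ℝ E] [FiniteDimensional ℝ E]

/-- The orthogonal projection of `V` onto the tangent space of the immersion `F`. -/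
def tangentProjection (F : E → V) (z : E) : V →L[ℝ] V :=
  (fderiv ℝ F z).range.starProjection

/-- The derivative of the tangent projection in the direction of the tangential part of a vector
of `V`. This makes it a family of bilinear maps on the fixed space `V`. -/
def projectionDeriv (F : E → V) (z : E) : V →L[ℝ] V →L[ℝ] V :=
  fderiv ℝ (tangentProjection F) z ∘L leftInverse (fderiv ℝ F z)

/-- The derivative of `projectionDeriv` in the direction of the tangential part of a vector. -/
def projectionDeriv₂ (F : E → V) (z : E) : V →L[ℝ] V →L[ℝ] V →L[ℝ] V :=
  fderiv ℝ (projectionDeriv F) z ∘L leftInverse (fderiv ℝ F z)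

/-- The vector field on `E` that the immersion `F` maps to the tangential part of the constant
field `u`. -/
def localField (F : E → V) (u : V) (z : E) : E :=
  leftInverse (fderiv ℝ F z) u

variable {F : E → V} {z z₀ : E}

theorem eventually_contDiffAt_and_injective (hF : ContDiffAt ℝ 3 F z₀)
    (hinj : Function.Injective (fderiv ℝ F z₀)) :
    ∀ᶠ z in 𝓝 z₀, ContDiffAt ℝ 3 F z ∧ Function.Injective (fderiv ℝ F z) :=
  (hF.eventually (by simp)).and <|
    (hF.fderiv_right (m := 2) (by norm_num)).continuousAt.eventually
      (ContinuousLinearMap.isOpen_injective.mem_nhds hinj)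

theorem contDiffAt_leftInverse_fderiv (hF : ContDiffAt ℝ 3 F z)
    (hinj : Function.Injective (fderiv ℝ F z)) :
    ContDiffAt ℝ 2 (fun z => leftInverse (fderiv ℝ F z)) z :=
  (contDiffAt_leftInverse hinj).comp z (hF.fderiv_right (by norm_num))

theorem contDiffAt_localField (hF : ContDiffAt ℝ 3 F z)
    (hinj : Function.Injective (fderiv ℝ F z)) (u : V) : ContDiffAt ℝ 2 (localField F u) z :=
  (contDiffAt_leftInverse_fderiv hF hinj).clm_apply contDiffAt_const

theorem contDiffAt_tangentProjection (hF : ContDiffAt ℝ 3 F z)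
    (hinj : Function.Injective (fderiv ℝ F z)) : ContDiffAt ℝ 2 (tangentProjection F) z := by
  have hcomp : ContDiffAt ℝ 2 (fun z => fderiv ℝ F z ∘L leftInverse (fderiv ℝ F z)) z :=
    (hF.fderiv_right (by norm_num)).clm_comp (contDiffAt_leftInverse_fderiv hF hinj)
  refine hcomp.congr_of_eventuallyEq ?_
  filter_upwards [eventually_contDiffAt_and_injective hF hinj] with z hz
  exact ContinuousLinearMap.ext fun v => (apply_leftInverse hz.2 v).symm

theorem contDiffAt_projectionDeriv (hF : ContDiffAt ℝ 3 F z)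
    (hinj : Function.Injective (fderiv ℝ F z)) : ContDiffAt ℝ 1 (projectionDeriv F) z :=
  ((contDiffAt_tangentProjection hF hinj).fderiv_right (by norm_num)).clm_comp
    ((contDiffAt_leftInverse_fderiv hF hinj).of_le (by norm_num))

theorem differentiableAt_tangentProjection (hF : ContDiffAt ℝ 3 F z)
    (hinj : Function.Injective (fderiv ℝ F z)) : DifferentiableAt ℝ (tangentProjection F) z :=
  (contDiffAt_tangentProjection hF hinj).differentiableAt (by simp)

theorem differentiableAt_projectionDeriv (hF : ContDiffAt ℝ 3 F z)
    (hinj : Function.Injective (fderiv ℝ F z)) : DifferentiableAt ℝ (projectionDeriv F) z :=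
  (contDiffAt_projectionDeriv hF hinj).differentiableAt (by simp)

theorem isSymmetric_projectionDeriv (hF : ContDiffAt ℝ 3 F z)
    (hinj : Function.Injective (fderiv ℝ F z)) (v : V) :
    (projectionDeriv F z v).toLinearMap.IsSymmetric :=
  isSymmetric_fderiv_apply (differentiableAt_tangentProjection hF hinj)
    (.of_forall fun _ => Submodule.starProjection_isSymmetric _) _

theorem projectionDeriv_apply_tangentProjection_add (hF : ContDiffAt ℝ 3 F z)
    (hinj : Function.Injective (fderiv ℝ F z)) (v w : V) :
    projectionDeriv F z v (tangentProjection F z w) +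
      tangentProjection F z (projectionDeriv F z v w) = projectionDeriv F z v w := by
  have hP := differentiableAt_tangentProjection hF hinj
  have hidem : (fun z => tangentProjection F z ∘L tangentProjection F z) = tangentProjection F :=
    funext fun z => Submodule.isIdempotentElem_starProjection _
  exact (fderiv_comp_apply hP hP _ w).symm.trans (by rw [hidem]; rfl)

theorem projectionDeriv_fderiv_apply (hF : ContDiffAt ℝ 3 F z)
    (hinj : Function.Injective (fderiv ℝ F z)) (X Y : E) :
    projectionDeriv F z (fderiv ℝ F z X) (fderiv ℝ F z Y) =
      (fderiv ℝ F z).rangeᗮ.starProjection (fderiv ℝ (fderiv ℝ F) z X Y) := by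
  have hA : DifferentiableAt ℝ (fderiv ℝ F) z :=
    (hF.fderiv_right (m := 2) (by norm_num)).differentiableAt (by simp)
  have htangent : (fun z => tangentProjection F z ∘L fderiv ℝ F z) = fderiv ℝ F :=
    funext fun z => ContinuousLinearMap.ext fun X =>
      Submodule.starProjection_eq_self_iff.mpr (LinearMap.mem_range_self _ X)
  have hderiv := fderiv_comp_apply (differentiableAt_tangentProjection hF hinj) hA X Y
  rw [htangent] at hderiv
  rw [Submodule.starProjection_orthogonal_val, projectionDeriv, ContinuousLinearMap.comp_apply,
    leftInverse_apply_apply hinj]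
  exact eq_sub_of_add_eq hderiv.symm

theorem isTangentProjectionDeriv_projectionDeriv (hF : ContDiffAt ℝ 3 F z)
    (hinj : Function.Injective (fderiv ℝ F z)) :
    IsTangentProjectionDeriv (fderiv ℝ F z).range (projectionDeriv F z) where
  isSymmetric := isSymmetric_projectionDeriv hF hinj
  apply_starProjection_add := projectionDeriv_apply_tangentProjection_add hF hinj
  starProjection_apply v := congrArg (fderiv ℝ (tangentProjection F) z)
    (leftInverse_starProjection hinj v)
  apply_comm := by
    rintro _ ⟨X, rfl⟩ _ ⟨Y, rfl⟩
    have hsymm : IsSymmSndFDerivAt ℝ F z := hF.isSymmSndFDerivAt (by norm_num)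
    exact (projectionDeriv_fderiv_apply hF hinj X Y).trans <|
      (congrArg _ (hsymm.eq X Y)).trans (projectionDeriv_fderiv_apply hF hinj Y X).symm

theorem isSymmetric_projectionDeriv₂ (hF : ContDiffAt ℝ 3 F z)
    (hinj : Function.Injective (fderiv ℝ F z)) (u v : V) :
    (projectionDeriv₂ F z u v).toLinearMap.IsSymmetric := by
  have hT := differentiableAt_projectionDeriv hF hinj
  have hsymm := isSymmetric_fderiv_apply (hT.clm_apply (differentiableAt_const v))
    ((eventually_contDiffAt_and_injective hF hinj).mono fun z hz =>
      isSymmetric_projectionDeriv hz.1 hz.2 v) (leftInverse (fderiv ℝ F z) u)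
  rwa [fderiv_apply_const hT] at hsymm

theorem projectionDeriv₂_tangentProjection (hinj : Function.Injective (fderiv ℝ F z)) (u : V) :
    projectionDeriv₂ F z (tangentProjection F z u) = projectionDeriv₂ F z u :=
  congrArg (fderiv ℝ (projectionDeriv F) z) (leftInverse_starProjection hinj u)

theorem projectionDeriv₂_apply_tangentProjection_add (hF : ContDiffAt ℝ 3 F z)
    (hinj : Function.Injective (fderiv ℝ F z)) (u v w : V) :
    projectionDeriv₂ F z u v (tangentProjection F z w) +
        projectionDeriv F z v (projectionDeriv F z u w) +
      (projectionDeriv F z u (projectionDeriv F z v w) +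
        tangentProjection F z (projectionDeriv₂ F z u v w)) = projectionDeriv₂ F z u v w := by
  have hP := differentiableAt_tangentProjection hF hinj
  have hT := differentiableAt_projectionDeriv hF hinj
  have hTv : DifferentiableAt ℝ (fun z => projectionDeriv F z v) z :=
    hT.clm_apply (differentiableAt_const v)
  have hadd : (fun z => projectionDeriv F z v ∘L tangentProjection F z +
      tangentProjection F z ∘L projectionDeriv F z v) =ᶠ[𝓝 z] fun z => projectionDeriv F z v := by
    filter_upwards [eventually_contDiffAt_and_injective hF hinj] with z hz
    exact ContinuousLinearMap.ext (projectionDeriv_apply_tangentProjection_add hz.1 hz.2 v)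
  have hderiv := congrArg (fun Q : E →L[ℝ] V →L[ℝ] V => Q (leftInverse (fderiv ℝ F z) u) w)
    (hadd.fderiv_eq (𝕜 := ℝ))
  simp only [fderiv_fun_add (hTv.clm_comp hP) (hP.clm_comp hTv), add_apply,
    fderiv_comp_apply hTv hP, fderiv_comp_apply hP hTv, fderiv_apply_const hT] at hderiv
  exact hderiv

theorem sum_frameSecondVariation_projectionDeriv [FiniteDimensional ℝ V] {ι κ₁ κ₂ : Type*}
    [Fintype ι] [Fintype κ₁] [Fintype κ₂] (hF : ContDiffAt ℝ 3 F z)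
    (hinj : Function.Injective (fderiv ℝ F z)) (b : OrthonormalBasis ι ℝ V) {e : κ₁ → V}
    {n : κ₂ → V} (g : OrthonormalBasis (κ₁ ⊕ κ₂) ℝ (fderiv ℝ F z).range)
    (hg : ∀ a, (g a : V) = Sum.elim e n a) :
    ∑ i, frameSecondVariation (projectionDeriv F z) (projectionDeriv₂ F z) e (b i) =
      ∑ j, ∑ k, (2 * ‖projectionDeriv F z (e j) (n k)‖ ^ 2 -
        ⟪projectionDeriv F z (e j) (e j), projectionDeriv F z (n k) (n k)⟫_ℝ) :=
  (isTangentProjectionDeriv_projectionDeriv hF hinj).sum_frameSecondVariation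
    (isSymmetric_projectionDeriv₂ hF hinj) (projectionDeriv₂_tangentProjection hinj)
    (projectionDeriv₂_apply_tangentProjection_add hF hinj) b g hg

end Immersion

section FrameTransport

variable {V : Type*} [NormedAddCommGroup V] [InnerProductSpace ℝ V]
  {E : Type*} [NormedAddCommGroup E] [NormedSpace ℝ E] [FiniteDimensional ℝ E]
  {F : E → V} {u : V} {c : ℝ → E} {t : ℝ}

theorem fderiv_fderiv_localField_add {z : E} (hF : ContDiffAt ℝ 3 F z)
    (hinj : Function.Injective (fderiv ℝ F z)) (X : E) :
    fderiv ℝ (fderiv ℝ F) z (localField F u z) X + fderiv ℝ F z (fderiv ℝ (localField F u) z X) =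
      projectionDeriv F z (fderiv ℝ F z X) u := by
  have hA : DifferentiableAt ℝ (fderiv ℝ F) z :=
    (hF.fderiv_right (m := 2) (by norm_num)).differentiableAt (by simp)
  have hY := (contDiffAt_localField hF hinj u).differentiableAt (by simp)
  have htangent : (fun z => fderiv ℝ F z (localField F u z)) =ᶠ[𝓝 z]
      fun z => tangentProjection F z u := by
    filter_upwards [eventually_contDiffAt_and_injective hF hinj] with z hz
    exact apply_leftInverse hz.2 u
  have hderiv := congrArg (fun ℓ : E →L[ℝ] V => ℓ X) (htangent.fderiv_eq (𝕜 := ℝ))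
  have hsymm : IsSymmSndFDerivAt ℝ F z := hF.isSymmSndFDerivAt (by norm_num)
  simp only [fderiv_clm_apply hA hY,
    fderiv_apply_const (differentiableAt_tangentProjection hF hinj), add_apply,
    ContinuousLinearMap.comp_apply, ContinuousLinearMap.flip_apply] at hderiv
  rw [projectionDeriv, ContinuousLinearMap.comp_apply, leftInverse_apply_apply hinj, ← hderiv,
    hsymm.eq, add_comm]

theorem hasDerivAt_fderiv_apply_of_variation {ξ : ℝ → E} (hF : ContDiffAt ℝ 3 F (c t))
    (hinj : Function.Injective (fderiv ℝ F (c t))) (hc : HasDerivAt c (localField F u (c t)) t)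
    (hξ : HasDerivAt ξ (fderiv ℝ (localField F u) (c t) (ξ t)) t) :
    HasDerivAt (fun s => fderiv ℝ F (c s) (ξ s))
      (projectionDeriv F (c t) (fderiv ℝ F (c t) (ξ t)) u) t := by
  have hA : DifferentiableAt ℝ (fderiv ℝ F) (c t) :=
    (hF.fderiv_right (m := 2) (by norm_num)).differentiableAt (by simp)
  rw [← fderiv_fderiv_localField_add hF hinj]
  exact (hA.hasFDerivAt.comp_hasDerivAt t hc).clm_apply hξ

variable {w : ℝ → V}

theorem hasDerivAt_projectionDeriv_apply (hF : ContDiffAt ℝ 3 F (c t))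
    (hinj : Function.Injective (fderiv ℝ F (c t))) (hc : HasDerivAt c (localField F u (c t)) t)
    (hw : HasDerivAt w (projectionDeriv F (c t) (w t) u) t) :
    HasDerivAt (fun s => projectionDeriv F (c s) (w s) u)
      (projectionDeriv₂ F (c t) u (w t) u +
        projectionDeriv F (c t) (projectionDeriv F (c t) (w t) u) u) t := by
  have hT : HasDerivAt (fun s => projectionDeriv F (c s)) (projectionDeriv₂ F (c t) u) t :=
    HasFDerivAt.comp_hasDerivAt (l := projectionDeriv F) t
      (differentiableAt_projectionDeriv hF hinj).hasFDerivAt hc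
  simpa using (hT.clm_apply hw).clm_apply (hasDerivAt_const t u)

theorem contDiffAt_two_of_hasDerivAt_projectionDeriv (hF : ContDiffAt ℝ 3 F (c t))
    (hinj : Function.Injective (fderiv ℝ F (c t)))
    (hc : ∀ᶠ s in 𝓝 t, HasDerivAt c (localField F u (c s)) s)
    (hw : ∀ᶠ s in 𝓝 t, HasDerivAt w (projectionDeriv F (c s) (w s) u) s) :
    ContDiffAt ℝ 2 w t := by
  have hfield : ContDiffAt ℝ 1
      (fun q : E × V => (localField F u q.1, projectionDeriv F q.1 q.2 u)) (c t, w t) :=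
    (((contDiffAt_localField hF hinj u).of_le (by norm_num)).comp (c t, w t) contDiffAt_fst).prodMk
      ((((contDiffAt_projectionDeriv hF hinj).comp (c t, w t) contDiffAt_fst).clm_apply
        contDiffAt_snd).clm_apply contDiffAt_const)
  have hpair : ContDiffAt ℝ 2 (fun s => (c s, w s)) t :=
    contDiffAt_succ_of_hasDerivAt 1 hfield (hc.and hw |>.mono fun s hs => hs.1.prodMk hs.2)
  exact contDiffAt_snd.comp t hpair

variable {κ : Type*} [Fintype κ] [DecidableEq κ] {ξ : κ → ℝ → E}

theorem contDiffAt_sqrt_det_gram_fderiv (hF : ContDiffAt ℝ 3 F (c t))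
    (hinj : Function.Injective (fderiv ℝ F (c t)))
    (hc : ∀ᶠ s in 𝓝 t, HasDerivAt c (localField F u (c s)) s)
    (hξ : ∀ᶠ s in 𝓝 t, ∀ j, HasDerivAt (ξ j) (fderiv ℝ (localField F u) (c s) (ξ j s)) s)
    (horth : Orthonormal ℝ fun j => fderiv ℝ F (c t) (ξ j t)) :
    ContDiffAt ℝ 2 (fun s => √(Matrix.gram ℝ fun j => fderiv ℝ F (c s) (ξ j s)).det) t := by
  have hnear := hc.self_of_nhds.continuousAt.eventually
    (eventually_contDiffAt_and_injective hF hinj)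
  refine contDiffAt_sqrt_det_gram (fun j => ?_) horth
  refine contDiffAt_two_of_hasDerivAt_projectionDeriv hF hinj hc ?_
  filter_upwards [hnear, hc, hξ] with s hs hcs hξs
  exact hasDerivAt_fderiv_apply_of_variation hs.1 hs.2 hcs (hξs j)

theorem iteratedDeriv_two_sqrt_det_gram_fderiv (hF : ContDiffAt ℝ 3 F (c t))
    (hinj : Function.Injective (fderiv ℝ F (c t)))
    (hc : ∀ᶠ s in 𝓝 t, HasDerivAt c (localField F u (c s)) s)
    (hξ : ∀ᶠ s in 𝓝 t, ∀ j, HasDerivAt (ξ j) (fderiv ℝ (localField F u) (c s) (ξ j s)) s)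
    (horth : Orthonormal ℝ fun j => fderiv ℝ F (c t) (ξ j t)) :
    iteratedDeriv 2 (fun s => √(Matrix.gram ℝ fun j => fderiv ℝ F (c s) (ξ j s)).det) t =
      frameSecondVariation (projectionDeriv F (c t)) (projectionDeriv₂ F (c t))
        (fun j => fderiv ℝ F (c t) (ξ j t)) u := by
  have hnear := hc.self_of_nhds.continuousAt.eventually
    (eventually_contDiffAt_and_injective hF hinj)
  have hw : ∀ᶠ s in 𝓝 t, ∀ j, HasDerivAt (fun s => fderiv ℝ F (c s) (ξ j s))
      (projectionDeriv F (c s) (fderiv ℝ F (c s) (ξ j s)) u) s := by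
    filter_upwards [hnear, hc, hξ] with s hs hcs hξs j
    exact hasDerivAt_fderiv_apply_of_variation hs.1 hs.2 hcs (hξs j)
  have hT := isTangentProjectionDeriv_projectionDeriv hF hinj
  have hflip : ∀ i j, ⟪projectionDeriv F (c t) (fderiv ℝ F (c t) (ξ i t)) u,
      fderiv ℝ F (c t) (ξ j t)⟫_ℝ = ⟪u, projectionDeriv F (c t) (fderiv ℝ F (c t) (ξ i t))
        (fderiv ℝ F (c t) (ξ j t))⟫_ℝ := fun i j => hT.isSymmetric _ u _
  exact iteratedDeriv_two_sqrt_det_gram (w := fun j s => fderiv ℝ F (c s) (ξ j s))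
    (w' := fun j s => projectionDeriv F (c s) (fderiv ℝ F (c s) (ξ j s)) u) hw
    (fun j => hasDerivAt_projectionDeriv_apply hF hinj hc.self_of_nhds (hw.self_of_nhds j)) horth
    fun i j => by
      rw [real_inner_comm, hflip, hflip]
      exact congrArg (inner ℝ u) (hT.apply_comm _ (LinearMap.mem_range_self _ _) _
        (LinearMap.mem_range_self _ _))

end FrameTransport

section VectorField

variable {E : Type*} [NormedAddCommGroup E] [NormedSpace ℝ E]
  {M : Type*} [TopologicalSpace M] [ChartedSpace E M]

/-- The differential at `y` of the chart at `x`. -/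
def chartDeriv (x y : M) : TangentSpace 𝓘(ℝ, E) y →L[ℝ] E :=
  mfderiv 𝓘(ℝ, E) 𝓘(ℝ, E) (extChartAt 𝓘(ℝ, E) x) y

/-- The expression of the vector field `v` in the chart at `x`. -/
def chartField (v : (y : M) → TangentSpace 𝓘(ℝ, E) y) (x : M) (z : E) : E :=
  chartDeriv x ((extChartAt 𝓘(ℝ, E) x).symm z) (v ((extChartAt 𝓘(ℝ, E) x).symm z))

theorem hasMFDerivAt_extChartAt_self [IsManifold 𝓘(ℝ, E) 1 M] (x : M) :
    HasMFDerivAt 𝓘(ℝ, E) 𝓘(ℝ, E) (extChartAt 𝓘(ℝ, E) x) x (ContinuousLinearMap.id ℝ E) :=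
  (mdifferentiableAt_extChartAt (mem_chart_source E x)).hasMFDerivAt.congr_mfderiv
    mfderiv_extChartAt_self

theorem bijective_chartDeriv [IsManifold 𝓘(ℝ, E) 1 M] (x : M) {y : M}
    (hy : y ∈ (extChartAt 𝓘(ℝ, E) x).source) : Function.Bijective (chartDeriv (E := E) x y) :=
  (isInvertible_mfderiv_extChartAt hy).bijective

variable {v : (y : M) → TangentSpace 𝓘(ℝ, E) y} {x : M}

theorem isMIntegralCurveOn_extChartAt_symm_comp [IsManifold 𝓘(ℝ, E) 1 M] {c : ℝ → E} {s : Set ℝ}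
    (hs : ∀ t ∈ s, c t ∈ (extChartAt 𝓘(ℝ, E) x).target)
    (hc : ∀ t ∈ s, HasDerivAt c (chartField v x (c t)) t) :
    IsMIntegralCurveOn (I := 𝓘(ℝ, E)) (fun t => (extChartAt 𝓘(ℝ, E) x).symm (c t)) v s := by
  intro t ht
  have hz := hs t ht
  have hsymm : MDifferentiableAt 𝓘(ℝ, E) 𝓘(ℝ, E) (extChartAt 𝓘(ℝ, E) x).symm (c t) :=
    ((contMDiffOn_extChartAt_symm (n := 1) x).contMDiffAt
      ((isOpen_extChartAt_target x).mem_nhds hz)).mdifferentiableAt one_ne_zero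
  have hvelocity : mfderiv 𝓘(ℝ, E) 𝓘(ℝ, E) (extChartAt 𝓘(ℝ, E) x).symm (c t)
      (chartField (E := E) v x (c t)) = v ((extChartAt 𝓘(ℝ, E) x).symm (c t)) := by
    apply (bijective_chartDeriv x ((extChartAt 𝓘(ℝ, E) x).map_target hz)).1
    have hcomp := mfderiv_extChartAt_comp_mfderivWithin_extChartAt_symm (I := 𝓘(ℝ, E)) hz
    simp only [modelWithCornersSelf_coe, range_id, mfderivWithin_univ] at hcomp
    exact DFunLike.congr_fun hcomp (chartField v x (c t))
  have hcomp := hsymm.hasMFDerivAt.comp t (hc t ht).hasFDerivAt.hasMFDerivAt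
  refine hcomp.hasMFDerivWithinAt.congr_mfderiv (ContinuousLinearMap.ext fun r : ℝ => ?_)
  exact (map_smul (mfderiv 𝓘(ℝ, E) 𝓘(ℝ, E) (extChartAt 𝓘(ℝ, E) x).symm (c t)) r
    (chartField v x (c t))).trans (congrArg (fun w : E => r • w) hvelocity)

theorem contMDiff_one_of_contDiffAt_chartField [IsManifold 𝓘(ℝ, E) 2 M]
    (hv : ∀ x, ContDiffAt ℝ 1 (chartField v x) (extChartAt 𝓘(ℝ, E) x x)) :
    ContMDiff 𝓘(ℝ, E) 𝓘(ℝ, E).tangent 1 (fun y => (⟨y, v y⟩ : TangentBundle 𝓘(ℝ, E) M)) := by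
  intro x
  have hcomp : ContMDiffAt 𝓘(ℝ, E) 𝓘(ℝ, E) 1
      (fun y => chartField v x (extChartAt 𝓘(ℝ, E) x y)) x :=
    (hv x).contMDiffAt.comp x contMDiffAt_extChartAt
  refine (Bundle.contMDiffAt_section x).mpr (hcomp.congr_of_eventuallyEq ?_)
  filter_upwards [chart_source_mem_nhds E x] with y hy
  rw [chartField, (extChartAt 𝓘(ℝ, E) x).left_inv (by simpa only [extChartAt_source] using hy),
    chartDeriv, ← TangentBundle.continuousLinearMapAt_trivializationAt hy,
    Bundle.Trivialization.continuousLinearMapAt_apply,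
    Bundle.Trivialization.coe_linearMapAt_of_mem _ hy]

end VectorField

section Flow

variable {E : Type*} [NormedAddCommGroup E] [NormedSpace ℝ E]
  {M : Type*} [TopologicalSpace M] [ChartedSpace E M]
  {v : (y : M) → TangentSpace 𝓘(ℝ, E) y} {x : M}

theorem flow_zero_and_isMIntegralCurve_flow {y : M}
    (h : ∃ γ : ℝ → M, γ 0 = y ∧ IsMIntegralCurve (I := 𝓘(ℝ, E)) γ v) :
    flow v 0 y = y ∧ IsMIntegralCurve (I := 𝓘(ℝ, E)) (fun t => flow v t y) v := by
  have hflow : (fun t => flow v t y) = h.choose := funext fun t => dif_pos h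
  exact ⟨(congrFun hflow 0).trans h.choose_spec.1, hflow ▸ h.choose_spec.2⟩

variable [CompleteSpace E]

theorem eventually_exists_isMIntegralCurveOn [IsManifold 𝓘(ℝ, E) 1 M]
    (hv : ContDiffAt ℝ 1 (chartField v x) (extChartAt 𝓘(ℝ, E) x x)) :
    ∃ ε > 0, ∀ᶠ y in 𝓝 x, ∃ γ : ℝ → M, γ 0 = y ∧
      IsMIntegralCurveOn (I := 𝓘(ℝ, E)) γ v (Ioo (-ε) ε) := by
  obtain ⟨ε, hε, Φ, hΦ⟩ := exists_localFlow hv (extChartAt_target_mem_nhds x)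
  refine ⟨ε, hε, ?_⟩
  filter_upwards [(continuousAt_extChartAt (I := 𝓘(ℝ, E)) x).eventually hΦ,
    extChartAt_source_mem_nhds (I := 𝓘(ℝ, E)) x] with y hy hmem
  exact ⟨fun t => (extChartAt 𝓘(ℝ, E) x).symm (Φ (extChartAt 𝓘(ℝ, E) x y) t),
    (congrArg _ hy.1).trans ((extChartAt 𝓘(ℝ, E) x).left_inv hmem),
    isMIntegralCurveOn_extChartAt_symm_comp (fun t ht => (hy.2 t ht).2) fun t ht => (hy.2 t ht).1⟩

variable [T2Space M] [IsManifold 𝓘(ℝ, E) 2 M]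

theorem exists_isMIntegralCurve_of_compactSpace [CompactSpace M]
    (hv : ∀ x, ContDiffAt ℝ 1 (chartField v x) (extChartAt 𝓘(ℝ, E) x x)) (y : M) :
    ∃ γ : ℝ → M, γ 0 = y ∧ IsMIntegralCurve (I := 𝓘(ℝ, E)) γ v := by
  choose ε hε hγ using fun x => eventually_exists_isMIntegralCurveOn (hv x)
  obtain ⟨S, -, hS⟩ := isCompact_univ.elim_nhds_subcover _ fun x _ => hγ x
  have hsmall : ∀ᶠ δ in 𝓝[>] (0 : ℝ), ∀ x ∈ S, δ ≤ ε x := (eventually_all_finset S).mpr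
    fun x _ => (eventually_le_nhds (hε x)).filter_mono nhdsWithin_le_nhds
  obtain ⟨δ, hδε, hδ⟩ := (hsmall.and self_mem_nhdsWithin).exists
  refine exists_isMIntegralCurve_of_isMIntegralCurveOn
    (contMDiff_one_of_contDiffAt_chartField hv) (mem_Ioi.mp hδ) (fun y => ?_) y
  obtain ⟨x, hx, γ, hγ0, hγ⟩ := mem_iUnion₂.mp (hS (mem_univ y))
  exact ⟨γ, hγ0, hγ.mono (Ioo_subset_Ioo (neg_le_neg (hδε x hx)) (hδε x hx))⟩

theorem exists_flow_eventuallyEq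
    (hv : ∀ x, ContDiffAt ℝ 1 (chartField v x) (extChartAt 𝓘(ℝ, E) x x))
    (hcomplete : ∀ y, ∃ γ : ℝ → M, γ 0 = y ∧ IsMIntegralCurve (I := 𝓘(ℝ, E)) γ v)
    (hvx : ContDiffAt ℝ 2 (chartField v x) (extChartAt 𝓘(ℝ, E) x x)) :
    ∃ (Φ : E → ℝ → E) (D : ℝ → E →L[ℝ] E),
      Φ (extChartAt 𝓘(ℝ, E) x x) 0 = extChartAt 𝓘(ℝ, E) x x ∧
      D 0 = ContinuousLinearMap.id ℝ E ∧
      ∀ᶠ t in 𝓝 0, flow v t =ᶠ[𝓝 x]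
          (extChartAt 𝓘(ℝ, E) x).symm ∘ (fun z => Φ z t) ∘ extChartAt 𝓘(ℝ, E) x ∧
        Φ (extChartAt 𝓘(ℝ, E) x x) t ∈ (extChartAt 𝓘(ℝ, E) x).target ∧
        HasDerivAt (Φ (extChartAt 𝓘(ℝ, E) x x))
          (chartField v x (Φ (extChartAt 𝓘(ℝ, E) x x) t)) t ∧
        HasDerivAt D (fderiv ℝ (chartField v x) (Φ (extChartAt 𝓘(ℝ, E) x x) t) ∘L D t) t ∧
        HasFDerivAt (fun z => Φ z t) (D t) (extChartAt 𝓘(ℝ, E) x x) := by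
  obtain ⟨ε, hε, Φ, D, hΦ, hD0, hD⟩ :=
    exists_localFlow_hasFDerivAt hvx (extChartAt_target_mem_nhds x)
  have hΦx := hΦ.self_of_nhds
  have hzero : (0 : ℝ) ∈ Ioo (-ε) ε := ⟨neg_lt_zero.mpr hε, hε⟩
  refine ⟨Φ, D, hΦx.1, hD0, ?_⟩
  filter_upwards [isOpen_Ioo.mem_nhds hzero] with t ht
  refine ⟨?_, (hΦx.2 t ht).2, (hΦx.2 t ht).1, hD t ht⟩
  filter_upwards [(continuousAt_extChartAt (I := 𝓘(ℝ, E)) x).eventually hΦ,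
    extChartAt_source_mem_nhds (I := 𝓘(ℝ, E)) x] with y hy hmem
  obtain ⟨hflow0, hflow⟩ := flow_zero_and_isMIntegralCurve_flow (hcomplete y)
  refine isMIntegralCurveOn_Ioo_eqOn_of_contMDiff_boundaryless hzero
    (contMDiff_one_of_contDiffAt_chartField hv)
    (hflow.isMIntegralCurveOn _) (isMIntegralCurveOn_extChartAt_symm_comp
      (fun t ht => (hy.2 t ht).2) fun t ht => (hy.2 t ht).1) ?_ ht
  rw [hflow0, hy.1, (extChartAt 𝓘(ℝ, E) x).left_inv hmem]

end Flow

theorem exists_orthonormalBasis_range {V E κ : Type*} [NormedAddCommGroup V]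
    [InnerProductSpace ℝ V] [AddCommGroup E] [Module ℝ E] [Fintype κ] {A : E →ₗ[ℝ] V} {g : κ → E}
    (horth : Orthonormal ℝ fun a => A (g a)) (hspan : Submodule.span ℝ (range g) = ⊤) :
    ∃ B : OrthonormalBasis κ ℝ A.range, ∀ a, (B a : V) = A (g a) := by
  have horth' : Orthonormal ℝ fun a => A.rangeRestrict (g a) :=
    horth.codRestrict _ fun a => LinearMap.mem_range_self A (g a)
  have hspan' : ⊤ ≤ Submodule.span ℝ (range fun a => A.rangeRestrict (g a)) := by
    rw [range_comp' A.rangeRestrict g, Submodule.span_image, hspan, Submodule.map_top,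
      LinearMap.range_rangeRestrict]
  exact ⟨OrthonormalBasis.mk horth' hspan', fun a => by rw [OrthonormalBasis.coe_mk]; rfl⟩

section ImmersedManifold

variable {V : Type*} [NormedAddCommGroup V] [InnerProductSpace ℝ V]
  {E : Type*} [NormedAddCommGroup E] [NormedSpace ℝ E]
  {M : Type*} [TopologicalSpace M] [ChartedSpace E M]

/-- The expression of `f` in the chart at `x`. -/
def localRep (f : M → V) (x : M) : E → V := f ∘ (extChartAt 𝓘(ℝ, E) x).symm

variable {f : M → V}

theorem contDiffAt_localRep {n : WithTop ℕ∞} [IsManifold 𝓘(ℝ, E) n M]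
    (hf : ContMDiff 𝓘(ℝ, E) 𝓘(ℝ, V) n f) (x : M) {z : E}
    (hz : z ∈ (extChartAt 𝓘(ℝ, E) x).target) : ContDiffAt ℝ n (localRep f x) z :=
  (hf.comp_contMDiffOn (contMDiffOn_extChartAt_symm x)).contDiffOn.contDiffAt
    ((isOpen_extChartAt_target x).mem_nhds hz)

theorem hasFDerivAt_localRep [IsManifold 𝓘(ℝ, E) 1 M] (hf : ContMDiff 𝓘(ℝ, E) 𝓘(ℝ, V) 1 f)
    (x : M) {z : E} (hz : z ∈ (extChartAt 𝓘(ℝ, E) x).target) :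
    HasFDerivAt (localRep f x) (fderiv ℝ (localRep f x) z) z :=
  ((contDiffAt_localRep hf x hz).differentiableAt one_ne_zero).hasFDerivAt

variable [IsManifold 𝓘(ℝ, E) 1 M]

theorem tangentMap_eq_fderiv_localRep_chartDeriv (hf : ContMDiff 𝓘(ℝ, E) 𝓘(ℝ, V) 1 f) (x : M)
    {y : M} (hy : y ∈ (extChartAt 𝓘(ℝ, E) x).source) (X : TangentSpace 𝓘(ℝ, E) y) :
    tangentMap f y X =
      fderiv ℝ (localRep f x) (extChartAt 𝓘(ℝ, E) x y) (chartDeriv x y X) := by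
  have hchart : HasMFDerivAt 𝓘(ℝ, E) 𝓘(ℝ, E) (extChartAt 𝓘(ℝ, E) x) y (chartDeriv x y) :=
    (mdifferentiableAt_extChartAt (by simpa only [extChartAt_source] using hy)).hasMFDerivAt
  have hcomp := (hasFDerivAt_localRep hf x
    ((extChartAt 𝓘(ℝ, E) x).map_source hy)).hasMFDerivAt.comp y hchart
  have heq : f =ᶠ[𝓝 y] localRep f x ∘ extChartAt 𝓘(ℝ, E) x := by
    filter_upwards [extChartAt_source_mem_nhds' hy] with y' hy'
    exact congrArg f ((extChartAt 𝓘(ℝ, E) x).left_inv hy').symm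
  rw [tangentMap, (hcomp.congr_of_eventuallyEq heq).mfderiv]
  rfl

theorem tangentMap_self (hf : ContMDiff 𝓘(ℝ, E) 𝓘(ℝ, V) 1 f) (x : M)
    (X : TangentSpace 𝓘(ℝ, E) x) :
    tangentMap f x X = fderiv ℝ (localRep f x) (extChartAt 𝓘(ℝ, E) x x) X :=
  (tangentMap_eq_fderiv_localRep_chartDeriv hf x (mem_extChartAt_source x) X).trans
    (congrArg _ (DFunLike.congr_fun (hasMFDerivAt_extChartAt_self x).mfderiv X))

theorem tangentSubspace_eq_range (hf : ContMDiff 𝓘(ℝ, E) 𝓘(ℝ, V) 1 f) (x : M) {y : M}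
    (hy : y ∈ (extChartAt 𝓘(ℝ, E) x).source) :
    tangentSubspace (E := E) f y =
      (fderiv ℝ (localRep f x) (extChartAt 𝓘(ℝ, E) x y)).range := by
  ext w
  constructor
  · rintro ⟨X, rfl⟩
    exact ⟨chartDeriv x y X, (tangentMap_eq_fderiv_localRep_chartDeriv hf x hy X).symm⟩
  · rintro ⟨X, rfl⟩
    obtain ⟨Y, rfl⟩ := (bijective_chartDeriv x hy).2 X
    exact ⟨Y, tangentMap_eq_fderiv_localRep_chartDeriv hf x hy Y⟩

theorem injective_fderiv_localRep (hf : ContMDiff 𝓘(ℝ, E) 𝓘(ℝ, V) 1 f) (x : M) {y : M}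
    (hy : y ∈ (extChartAt 𝓘(ℝ, E) x).source)
    (hinj : Function.Injective (tangentMap (E := E) f y)) :
    Function.Injective (fderiv ℝ (localRep f x) (extChartAt 𝓘(ℝ, E) x y)) := by
  intro X Y hXY
  obtain ⟨X, rfl⟩ := (bijective_chartDeriv x hy).2 X
  obtain ⟨Y, rfl⟩ := (bijective_chartDeriv x hy).2 Y
  rw [← tangentMap_eq_fderiv_localRep_chartDeriv hf x hy,
    ← tangentMap_eq_fderiv_localRep_chartDeriv hf x hy] at hXY
  rw [hinj hXY]

theorem exists_orthonormalBasis_range_fderiv_localRep (hf : ContMDiff 𝓘(ℝ, E) 𝓘(ℝ, V) 1 f)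
    {x : M} {κ : Type*} [Fintype κ] {g : κ → TangentSpace 𝓘(ℝ, E) x}
    (horth : Orthonormal ℝ fun a => tangentMap (E := E) f x (g a))
    (hspan : Submodule.span ℝ (range g) = ⊤) :
    ∃ B : OrthonormalBasis κ ℝ (fderiv ℝ (localRep f x) (extChartAt 𝓘(ℝ, E) x x)).range,
      ∀ a, (B a : V) = tangentMap f x (g a) := by
  have htangent a := tangentMap_self hf x (g a)
  simp only [htangent] at horth ⊢
  exact exists_orthonormalBasis_range horth hspan

theorem tangentMap_mfderiv_of_eventuallyEq (hf : ContMDiff 𝓘(ℝ, E) 𝓘(ℝ, V) 1 f) {x : M}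
    {φ : M → M} {Ψ : E → E} {A : E →L[ℝ] E}
    (hφ : φ =ᶠ[𝓝 x] (extChartAt 𝓘(ℝ, E) x).symm ∘ Ψ ∘ extChartAt 𝓘(ℝ, E) x)
    (htarget : Ψ (extChartAt 𝓘(ℝ, E) x x) ∈ (extChartAt 𝓘(ℝ, E) x).target)
    (hΨ : HasFDerivAt Ψ A (extChartAt 𝓘(ℝ, E) x x)) (X : E) :
    tangentMap (E := E) f (φ x) (mfderiv 𝓘(ℝ, E) 𝓘(ℝ, E) φ x X) =
      fderiv ℝ (localRep f x) (Ψ (extChartAt 𝓘(ℝ, E) x x)) (A X) := by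
  have hchart := hΨ.hasMFDerivAt.comp x (hasMFDerivAt_extChartAt_self x)
  have hsymm : MDifferentiableAt 𝓘(ℝ, E) 𝓘(ℝ, E) (extChartAt 𝓘(ℝ, E) x).symm
      ((Ψ ∘ extChartAt 𝓘(ℝ, E) x) x) :=
    ((contMDiffOn_extChartAt_symm (n := 1) x).contMDiffAt
      ((isOpen_extChartAt_target x).mem_nhds htarget)).mdifferentiableAt one_ne_zero
  have hφx : MDifferentiableAt 𝓘(ℝ, E) 𝓘(ℝ, E) φ x :=
    (hsymm.comp x hchart.mdifferentiableAt).congr_of_eventuallyEq hφ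
  have hlocal := ((hasFDerivAt_localRep hf x htarget).hasMFDerivAt.comp x
    hchart).congr_of_eventuallyEq (hφ.fun_comp f)
  have hcomp := mfderiv_comp x (hf.mdifferentiableAt one_ne_zero) hφx
  exact (DFunLike.congr_fun hcomp X).symm.trans (DFunLike.congr_fun hlocal.mfderiv X)

variable [FiniteDimensional ℝ V] [FiniteDimensional ℝ E]

theorem chartField_projField (hf : ContMDiff 𝓘(ℝ, E) 𝓘(ℝ, V) 1 f)
    (u : V) (x : M) {z : E} (hz : z ∈ (extChartAt 𝓘(ℝ, E) x).target)
    (hinj : Function.Injective (tangentMap (E := E) f ((extChartAt 𝓘(ℝ, E) x).symm z))) :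
    chartField (projField f u) x z = localField (localRep f x) u z := by
  have hy := (extChartAt 𝓘(ℝ, E) x).map_target hz
  have hz' := (extChartAt 𝓘(ℝ, E) x).right_inv hz
  have hinjz := hz' ▸ injective_fderiv_localRep hf x hy hinj
  have hmap := tangentMap_eq_fderiv_localRep_chartDeriv hf x hy (projField f u _)
  rw [hz', projField, (exists_tangentMap_eq f u _).choose_spec] at hmap
  apply hinjz
  rw [chartField, projField, ← hmap, localField, apply_leftInverse hinjz]
  simp only [tangentSubspace_eq_range hf x hy, hz']

end ImmersedManifold

section SecondVariation

variable {V : Type*} [NormedAddCommGroup V] [InnerProductSpace ℝ V] [FiniteDimensional ℝ V]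
  {E : Type*} [NormedAddCommGroup E] [NormedSpace ℝ E] [FiniteDimensional ℝ E]
  {M : Type*} [TopologicalSpace M] [ChartedSpace E M] [IsManifold 𝓘(ℝ, E) 3 M] {f : M → V}

theorem secondFundamentalForm_eq_projectionDeriv (hf : ContMDiff 𝓘(ℝ, E) 𝓘(ℝ, V) 3 f) {x : M}
    (hinj : Function.Injective (tangentMap (E := E) f x)) (X Y : TangentSpace 𝓘(ℝ, E) x) :
    secondFundamentalForm f x X Y = projectionDeriv (localRep f x) (extChartAt 𝓘(ℝ, E) x x)
      (tangentMap f x X) (tangentMap f x Y) := by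
  have hf₁ : ContMDiff 𝓘(ℝ, E) 𝓘(ℝ, V) 1 f := hf.of_le (by norm_num)
  have hF := contDiffAt_localRep hf x (mem_extChartAt_target x)
  have hA : DifferentiableAt ℝ (fderiv ℝ (localRep f x)) (extChartAt 𝓘(ℝ, E) x x) :=
    (hF.fderiv_right (m := 2) (by norm_num)).differentiableAt (by simp)
  have hform (X Y : E) : projectionDeriv (localRep f x) (extChartAt 𝓘(ℝ, E) x x)
      (fderiv ℝ (localRep f x) (extChartAt 𝓘(ℝ, E) x x) X)
      (fderiv ℝ (localRep f x) (extChartAt 𝓘(ℝ, E) x x) Y) =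
        secondFundamentalForm f x X Y := by
    rw [projectionDeriv_fderiv_apply hF
      (injective_fderiv_localRep hf₁ x (mem_extChartAt_source x) hinj), ← fderiv_apply_const hA]
    simp only [← tangentSubspace_eq_range hf₁ x (mem_extChartAt_source x)]
    rfl
  exact (hform X Y).symm.trans (congrArg₂ (fun v w => projectionDeriv _ _ v w)
    (tangentMap_self hf₁ x X) (tangentMap_self hf₁ x Y)).symm

theorem contDiffAt_chartField_projField (hf : ContMDiff 𝓘(ℝ, E) 𝓘(ℝ, V) 3 f)
    (hinj : ∀ y, Function.Injective (tangentMap (E := E) f y)) (u : V) (x : M) :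
    ContDiffAt ℝ 2 (chartField (projField f u) x) (extChartAt 𝓘(ℝ, E) x x) := by
  have hf₁ : ContMDiff 𝓘(ℝ, E) 𝓘(ℝ, V) 1 f := hf.of_le (by norm_num)
  have hlocal := contDiffAt_localField (contDiffAt_localRep hf x (mem_extChartAt_target x))
    (injective_fderiv_localRep hf₁ x (mem_extChartAt_source x) (hinj x)) u
  refine hlocal.congr_of_eventuallyEq ?_
  filter_upwards [extChartAt_target_mem_nhds (I := 𝓘(ℝ, E)) x] with z hz
  exact chartField_projField hf₁ u x hz (hinj _)

variable [T2Space M] [CompactSpace M]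

theorem exists_isMIntegralCurve_projField (hf : ContMDiff 𝓘(ℝ, E) 𝓘(ℝ, V) 3 f)
    (hinj : ∀ y, Function.Injective (tangentMap (E := E) f y)) (u : V) (y : M) :
    ∃ γ : ℝ → M, γ 0 = y ∧ IsMIntegralCurve (I := 𝓘(ℝ, E)) γ (projField f u) :=
  exists_isMIntegralCurve_of_compactSpace
    (fun x => (contDiffAt_chartField_projField hf hinj u x).of_le one_le_two) y

theorem exists_pushforwardNorm_projField_eventuallyEq (hf : ContMDiff 𝓘(ℝ, E) 𝓘(ℝ, V) 3 f)
    (hinj : ∀ y, Function.Injective (tangentMap (E := E) f y)) (u : V) (x : M) {p : ℕ}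
    (e : Fin p → TangentSpace 𝓘(ℝ, E) x) :
    ∃ (c : ℝ → E) (ξ : Fin p → ℝ → E), c 0 = extChartAt 𝓘(ℝ, E) x x ∧ (∀ j, ξ j 0 = e j) ∧
      (∀ᶠ t in 𝓝 0, HasDerivAt c (localField (localRep f x) u (c t)) t) ∧
      (∀ᶠ t in 𝓝 0, ∀ j,
        HasDerivAt (ξ j) (fderiv ℝ (localField (localRep f x) u) (c t) (ξ j t)) t) ∧
      pushforwardNorm f (projField (E := E) f u) x e =ᶠ[𝓝 0] fun t =>
        √(Matrix.gram ℝ fun j => fderiv ℝ (localRep f x) (c t) (ξ j t)).det := by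
  have hf₁ : ContMDiff 𝓘(ℝ, E) 𝓘(ℝ, V) 1 f := hf.of_le (by norm_num)
  obtain ⟨Φ, D, hΦ0, hD0, hflow⟩ := exists_flow_eventuallyEq
    (fun y => (contDiffAt_chartField_projField hf hinj u y).of_le one_le_two)
    (exists_isMIntegralCurve_projField hf hinj u) (contDiffAt_chartField_projField hf hinj u x)
  have hfield : EqOn (chartField (projField f u) x) (localField (localRep f x) u)
      (extChartAt 𝓘(ℝ, E) x).target := fun z hz => chartField_projField hf₁ u x hz (hinj _)
  refine ⟨Φ (extChartAt 𝓘(ℝ, E) x x), fun j t => D t (e j), hΦ0,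
    fun j => DFunLike.congr_fun hD0 (e j), ?_, ?_, ?_⟩
  · filter_upwards [hflow] with t ht
    exact hfield ht.2.1 ▸ ht.2.2.1
  · filter_upwards [hflow] with t ⟨_, htarget, _, hD, _⟩ j
    rw [(hfield.eventuallyEq_of_mem
      ((isOpen_extChartAt_target x).mem_nhds htarget)).fderiv_eq] at hD
    exact (ContinuousLinearMap.apply ℝ E _).hasFDerivAt.comp_hasDerivAt t hD
  · filter_upwards [hflow] with t ⟨hφ, htarget, _, _, hΦ⟩
    have hmap := tangentMap_mfderiv_of_eventuallyEq hf₁ hφ htarget hΦ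
    refine congrArg Real.sqrt (congrArg Matrix.det (Matrix.ext fun i j => ?_))
    exact congrArg₂ (inner ℝ) (hmap (e i)) (hmap (e j))

theorem contDiffAt_pushforwardNorm_projField (hf : ContMDiff 𝓘(ℝ, E) 𝓘(ℝ, V) 3 f)
    (hinj : ∀ y, Function.Injective (tangentMap (E := E) f y)) (u : V) (x : M) {p : ℕ}
    {e : Fin p → TangentSpace 𝓘(ℝ, E) x}
    (horth : Orthonormal ℝ fun j => tangentMap (E := E) f x (e j)) :
    ContDiffAt ℝ 2 (pushforwardNorm f (projField (E := E) f u) x e) 0 := by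
  have hf₁ : ContMDiff 𝓘(ℝ, E) 𝓘(ℝ, V) 1 f := hf.of_le (by norm_num)
  obtain ⟨c, ξ, hc0, hξ0, hc, hξ, heq⟩ :=
    exists_pushforwardNorm_projField_eventuallyEq hf hinj u x e
  refine ContDiffAt.congr_of_eventuallyEq
    (contDiffAt_sqrt_det_gram_fderiv (u := u) ?_ ?_ hc hξ ?_) heq
  · exact hc0 ▸ contDiffAt_localRep hf x (mem_extChartAt_target x)
  · exact hc0 ▸ injective_fderiv_localRep hf₁ x (mem_extChartAt_source x) (hinj x)
  · simpa only [hc0, hξ0, ← tangentMap_self hf₁] using horth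

theorem secondVariation_projField (hf : ContMDiff 𝓘(ℝ, E) 𝓘(ℝ, V) 3 f)
    (hinj : ∀ y, Function.Injective (tangentMap (E := E) f y)) (u : V) (x : M) {p : ℕ}
    {e : Fin p → TangentSpace 𝓘(ℝ, E) x}
    (horth : Orthonormal ℝ fun j => tangentMap (E := E) f x (e j)) :
    secondVariation f (projField (E := E) f u) x e =
      frameSecondVariation (projectionDeriv (localRep f x) (extChartAt 𝓘(ℝ, E) x x))
        (projectionDeriv₂ (localRep f x) (extChartAt 𝓘(ℝ, E) x x))
        (fun j => tangentMap (E := E) f x (e j)) u := by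
  have hf₁ : ContMDiff 𝓘(ℝ, E) 𝓘(ℝ, V) 1 f := hf.of_le (by norm_num)
  obtain ⟨c, ξ, hc0, hξ0, hc, hξ, heq⟩ :=
    exists_pushforwardNorm_projField_eventuallyEq hf hinj u x e
  have hvalue := iteratedDeriv_two_sqrt_det_gram_fderiv (u := u)
    (hc0 ▸ contDiffAt_localRep hf x (mem_extChartAt_target x))
    (hc0 ▸ injective_fderiv_localRep hf₁ x (mem_extChartAt_source x) (hinj x)) hc hξ
    (by simpa only [hc0, hξ0, ← tangentMap_self hf₁] using horth)
  simp only [hc0, hξ0, ← tangentMap_self hf₁] at hvalue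
  exact (heq.iteratedDeriv_eq 2).trans hvalue

end SecondVariation

end SymmetricOrbit

end

open SymmetricOrbit in
theorem mainTheorem2_general
    {V : Type*} [NormedAddCommGroup V] [InnerProductSpace ℝ V] [FiniteDimensional ℝ V]
    {E : Type*} [NormedAddCommGroup E] [NormedSpace ℝ E] [FiniteDimensional ℝ E]
    {M : Type*} [TopologicalSpace M] [T2Space M] [CompactSpace M]
    [ChartedSpace E M] [IsManifold 𝓘(ℝ, E) 3 M]
    (f : M → V) (hf : ContMDiff 𝓘(ℝ, E) 𝓘(ℝ, V) 3 f)
    (hinj : ∀ y, Function.Injective (tangentMap (E := E) f y))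
    (x : M) {p q : ℕ}
    (e : Fin p → TangentSpace 𝓘(ℝ, E) x) (n : Fin q → TangentSpace 𝓘(ℝ, E) x)
    (horth : Orthonormal ℝ fun i : Fin p ⊕ Fin q =>
      tangentMap (E := E) f x (Sum.elim e n i))
    (hspan : Submodule.span ℝ (Set.range (Sum.elim e n)) = ⊤)
    {ι : Type*} [Fintype ι] (b : OrthonormalBasis ι ℝ V) :
    (∀ (u : V) (y : M), flow (projField (E := E) f u) 0 y = y ∧
      IsMIntegralCurve (I := 𝓘(ℝ, E))
        (fun t => flow (projField (E := E) f u) t y)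
        (projField (E := E) f u)) ∧
    (∀ u : V, ContDiffAt ℝ 2
      (pushforwardNorm f (projField (E := E) f u) x e) 0) ∧
    ∑ i, secondVariation f (projField (E := E) f (b i)) x e =
      ∑ j, ∑ k,
        (2 * ‖secondFundamentalForm f x (e j) (n k)‖ ^ 2 -
          ⟪secondFundamentalForm f x (e j) (e j),
            secondFundamentalForm f x (n k) (n k)⟫_ℝ) := by
  have he : Orthonormal ℝ fun j => tangentMap (E := E) f x (e j) :=
    horth.comp Sum.inl Sum.inl_injective
  refine ⟨fun u y => flow_zero_and_isMIntegralCurve_flow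
      (exists_isMIntegralCurve_projField hf hinj u y),
    fun u => contDiffAt_pushforwardNorm_projField hf hinj u x he, ?_⟩
  have hf₁ : ContMDiff 𝓘(ℝ, E) 𝓘(ℝ, V) 1 f := hf.of_le (by norm_num)
  obtain ⟨g, hg⟩ := exists_orthonormalBasis_range_fderiv_localRep hf₁ horth hspan
  simp only [secondVariation_projField hf hinj _ x he,
    secondFundamentalForm_eq_projectionDeriv hf (hinj x)]
  refine sum_frameSecondVariation_projectionDeriv
    (contDiffAt_localRep hf x (mem_extChartAt_target x))
    (injective_fderiv_localRep hf₁ x (mem_extChartAt_source x) (hinj x)) b g fun a => ?_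
  rw [hg]
  cases a <;> rfl

theorem mainTheorem2
    {V : Type*} [NormedAddCommGroup V] [InnerProductSpace ℝ V] [FiniteDimensional ℝ V]
    -- the Lie group `G` and its orthogonal representation on `V`
    {EG : Type*} [NormedAddCommGroup EG] [NormedSpace ℝ EG] [FiniteDimensional ℝ EG]
    {G : Type*} [TopologicalSpace G] [ChartedSpace EG G] [Group G] [LieGroup 𝓘(ℝ, EG) ∞ G]
    (ρ : G →* (V ≃ₗᵢ[ℝ] V)) (hρ : ∀ w : V, Continuous fun g : G => ρ g w)
    -- the compact symmetric space `M = G/K`, embedded by `f` as the orbit of `v₀`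
    {E : Type*} [NormedAddCommGroup E] [NormedSpace ℝ E] [FiniteDimensional ℝ E]
    {M : Type*} [TopologicalSpace M] [T2Space M] [CompactSpace M]
    [ChartedSpace E M] [IsManifold 𝓘(ℝ, E) ∞ M]
    (f : M → V) (hf : SymmetricOrbit.IsInjectiveImmersion (E := E) f)
    (v₀ : V) (horbit : Set.range f = Set.range fun g : G => ρ g v₀)
    (hsymm : SymmetricOrbit.IsRiemannianSymmetric (E := E) f)
    -- the frame `e` at `x`, completed by `n` to an orthonormal basis of `T_x M`
    (x : M) {p q : ℕ}
    (e : Fin p → TangentSpace 𝓘(ℝ, E) x) (n : Fin q → TangentSpace 𝓘(ℝ, E) x)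
    (horth : Orthonormal ℝ fun i : Fin p ⊕ Fin q =>
      SymmetricOrbit.tangentMap (E := E) f x (Sum.elim e n i))
    (hspan : Submodule.span ℝ (Set.range (Sum.elim e n)) = ⊤)
    {ι : Type*} [Fintype ι] (b : OrthonormalBasis ι ℝ V) :
    (∀ (u : V) (y : M), SymmetricOrbit.flow (SymmetricOrbit.projField (E := E) f u) 0 y = y ∧
      IsMIntegralCurve (I := 𝓘(ℝ, E))
        (fun t => SymmetricOrbit.flow (SymmetricOrbit.projField (E := E) f u) t y)
        (SymmetricOrbit.projField (E := E) f u)) ∧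
    (∀ u : V, ContDiffAt ℝ 2
      (SymmetricOrbit.pushforwardNorm f (SymmetricOrbit.projField (E := E) f u) x e) 0) ∧
    ∑ i, SymmetricOrbit.secondVariation f (SymmetricOrbit.projField (E := E) f (b i)) x e =
      ∑ j, ∑ k,
        (2 * ‖SymmetricOrbit.secondFundamentalForm f x (e j) (n k)‖ ^ 2 -
          ⟪SymmetricOrbit.secondFundamentalForm f x (e j) (e j),
            SymmetricOrbit.secondFundamentalForm f x (n k) (n k)⟫_ℝ) := by
  exact mainTheorem2_general f (hf.contMDiff.of_le ENat.LEInfty.out) hf.injective_tangentMap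
    x e n horth hspan b
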